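/- For an integer $N\ge 0$ let $\mathrm{Sym}_N$ be the real vector space of real symmetric $N\times N$ matrices, and for $E\subset\mathbb R$ let ${\cal S}_N(E)\subset \mathrm{Sym}_N$ be the set of symmetric $N\times N$ matrices whose spectrum is contained in $E$. Let $V:\mathbb R\to\mathbb R$ be measurable, let $E\subset\mathbb R$ be measurable (for instance a union of intervals), and let $t=(t_1,t_2,\dots)$, $s=(s_1,s_2,\dots)$ be sequences of real numbers. With $\varepsilon(x)=\operatorname{sign}(x)$, put for $k,\ell\ge 0$ $$\mu_{k\ell}(t,s)=\int\!\!\int_{E^2}x^k y^\ell\, e^{V(x)+V(y)+\sum_{i\ge1}(t_ix^i-s_iy^i)}\,\varepsilon(x-y)\,dx\,dy,$$ $$\tau_\ell(t,s)=\det\bigl(\mu_{ij}(t,s)\bigr)_{0\le i,j\le \ell-1}\quad(\tau_0=1),\qquad \tilde\tau_{2n}(t)=\sqrt{\tau_{2n}(t,-t)}.$$ Say that $(V,E,t)$ is convergent at level $\ell$ if $\sum_{i\ge 1} t_ix^i$ converges absolutely for almost every $x\in E$ and the functions $x^k e^{V(x)+\sum_{i\ge 1} t_ix^i}$, $0\le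 k\le \ell-1$, are integrable on $E$. Write $\Delta_\ell$ for the Vandermonde determinant. **Theorem 5.1.** (a) For all $\ell\ge0$, if $(V,E,t)$ and $(V,E,-s)$ are convergent at level $\ell$, then $$\ell!\;\tau_\ell(t,s)=\int_{E^{2\ell}}\prod_{k=1}^{\ell}\Bigl(e^{V(x_k)+V(y_k)+\sum_{i\ge1}(t_ix_k^i-s_iy_k^i)}\,\varepsilon(x_k-y_k)\Bigr)\Delta_\ell(x)\,\Delta_\ell(y)\,dx_1\cdots dx_\ell\,dy_1\cdots dy_\ell ,$$ the integral being absolutely convergent. (b) Let $n\ge 0$ and let $dX$ be a Haar measure on the additive group $\mathrm{Sym}_{2n}$. There is a constant $c>0$, depending only on $n$ and on the normalization of $dX$ (not on $V$, $E$ or $t$), such that whenever $(V,E,t)$ is convergent at level $2n$, $$\tilde\tau_{2n}(t)=\sqrt{\tau_{2n}(t,-t)}=c\int_{{\cal S}_{2n}(E)}e^{\operatorname{Tr}\left(V(X)+\sum_{i\ge 1} t_iX^i\right)}\,dX,$$ the integral on the right being absolutely convergent. Here $V(X)$ is defined by the functional calculus of symmetric matrices. -/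

import Mathlib

open MeasureTheory

noncomputable section

namespace PfaffianTau

/-- The space of real symmetric `N × N` matrices, with the topology and vector space
structure inherited from the space of all matrices. -/
def symMatrices (N : ℕ) : Submodule ℝ (Matrix (Fin N) (Fin N) ℝ) where
  carrier := {X | X.IsSymm}
  add_mem' := fun hX hY => hX.add hY
  zero_mem' := Matrix.isSymm_zero
  smul_mem' := fun a _ hX => hX.smul a

/-- The Borel structure on the space of symmetric matrices. -/
instance instMeasurableSpaceSymMatrices (N : ℕ) : MeasurableSpace (symMatrices N) := borel _

instance instBorelSpaceSymMatrices (N : ℕ) : BorelSpace (symMatrices N) := ⟨rfl⟩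

/-- The set of symmetric `N × N` matrices all of whose eigenvalues lie in `E`. -/
def symWithSpectrumIn (N : ℕ) (E : Set ℝ) : Set (symMatrices N) :=
  {X | spectrum ℝ (X : Matrix (Fin N) (Fin N) ℝ) ⊆ E}

/-- The function `exp (Tr (V(X) + ∑_{i ≥ 1} t_i X^i))` of a symmetric matrix `X`, where `V(X)`
is given by the functional calculus of symmetric matrices. -/
def matrixWeight (V : ℝ → ℝ) (t : ℕ+ → ℝ) {N : ℕ} (X : symMatrices N) : ℝ :=
  Real.exp (Matrix.trace
    (cfc V (X : Matrix (Fin N) (Fin N) ℝ)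
      + ∑' i : ℕ+, t i • (X : Matrix (Fin N) (Fin N) ℝ) ^ (i : ℕ)))

/-- The skew-symmetric weight deformed by the times,
`exp (V(x) + V(y) + ∑_{i ≥ 1} (t_i x^i - s_i y^i)) ε(x - y)`, with `ε` the sign function.
The indicator functions of `E` are accounted for by the domains of integration below. -/
def skewWeight (V : ℝ → ℝ) (t s : ℕ+ → ℝ) (x y : ℝ) : ℝ :=
  Real.exp (V x + V y + ∑' i : ℕ+, (t i * x ^ (i : ℕ) - s i * y ^ (i : ℕ))) * Real.sign (x - y)

/-- The moment `μ_{kl}(t, s)`: the double integral over `E × E` of `x^k y^l` against the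
deformed skew-symmetric weight. -/
def moment (V : ℝ → ℝ) (E : Set ℝ) (t s : ℕ+ → ℝ) (k l : ℕ) : ℝ :=
  ∫ p in E ×ˢ E, p.1 ^ k * p.2 ^ l * skewWeight V t s p.1 p.2

/-- `τ_l(t, s) = det (μ_{ij}(t, s))_{0 ≤ i, j ≤ l - 1}`. -/
def tau (V : ℝ → ℝ) (E : Set ℝ) (l : ℕ) (t s : ℕ+ → ℝ) : ℝ :=
  Matrix.det (Matrix.of fun i j : Fin l => moment V E t s i j)

/-- The Pfaffian tau function `√(τ_N(t, -t))`, considered for even `N`. -/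
def pfaffianTau (V : ℝ → ℝ) (E : Set ℝ) (N : ℕ) (t : ℕ+ → ℝ) : ℝ :=
  Real.sqrt (tau V E N t (-t))

/-- The integrand of the multiple integral attached to `τ_l(t, s)`:
`∏_k (weight at (x_k, y_k)) Δ_l(x) Δ_l(y)`, with `Δ_l` the Vandermonde determinant. -/
def multiIntegrand (V : ℝ → ℝ) (t s : ℕ+ → ℝ) (l : ℕ) (x y : Fin l → ℝ) : ℝ :=
  (∏ k, skewWeight V t s (x k) (y k))
    * (Matrix.vandermonde x).det * (Matrix.vandermonde y).det

/-- The box `E^{2l}`, as a set of pairs `(x, y)` of points of `ℝ^l`. -/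
def box (E : Set ℝ) (l : ℕ) : Set ((Fin l → ℝ) × (Fin l → ℝ)) :=
  (Set.univ.pi fun _ => E) ×ˢ (Set.univ.pi fun _ => E)

/-- Convergence of everything that enters the `l × l` moment matrix: the series
`∑_{i ≥ 1} t_i x^i` converges for almost every `x ∈ E`, and the functions
`x^k exp (V(x) + ∑_{i ≥ 1} t_i x^i)` with `0 ≤ k ≤ l - 1` are integrable over `E`. -/
def Converges (V : ℝ → ℝ) (E : Set ℝ) (l : ℕ) (t : ℕ+ → ℝ) : Prop :=
  (∀ᵐ x ∂(volume.restrict E), Summable fun i : ℕ+ => t i * x ^ (i : ℕ)) ∧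
    ∀ k < l, IntegrableOn
      (fun x : ℝ => x ^ k * Real.exp (V x + ∑' i : ℕ+, t i * x ^ (i : ℕ))) E

end PfaffianTau

end

/-! Part (a) is Andréief's identity. Both Vandermonde determinants are expanded over permutations,
Fubini turns each term into a product of moments, and each of the `l !` choices of the first
permutation resums to the same determinant.

For part (b), the moment matrix at `s = -t` is skew-symmetric because `ε` is odd. Up to a factor
depending only on the size, its determinant is the square of a signed sum `pfSum` over all
permutations, a multiple of the Pfaffian (`exists_pfSum_sq`). De Bruijn's formula (`pfSum_moments`)
writes `pfSum` of the moments as an integral of `pfSum (sign (x_i - x_j)) Δ(x) ∏ w(x_i)`. Both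
`pfSum (sign (x_i - x_j))` and `Δ` are alternating in `x`, and the former is constant on increasing
tuples, so the integrand is `κ |Δ(x)| ∏ w(x_i)`, with `κ ≠ 0` by a parity argument. The square root
of the tau function is therefore a positive constant times `∫ |Δ| ∏ w` over `E^{2n}`.

It remains to recognize this as a matrix integral, by the Weyl integration formula `∫ H(X) dX = c ∫
H(diag d) |Δ(d)| dd` for orthogonally invariant `H` (`exists_weyl_coord`). No quotient of the
orthogonal group is used. The map `(d, k) ↦ U D Uᵀ`, with `U` the Cayley transform of a small skew
matrix `k`, is an injective chart with Jacobian `|Δ(d)| j(k)`. This gives the formula on its image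
`S`, and averaging conjugates of `S` over the compact orthogonal group (`exists_average_conj`)
compares the integral over `S` with the full one.

Since the series in the exponent converges only almost everywhere, null sets of the line must also
be carried over to null sets of matrices. This is again the Weyl formula (`ae_eigenvalues_notMem`).
-/

namespace PfaffianTau

open Matrix Equiv

/-! ### Pfaffians as signed sums, and their squares -/

section Pfaffian

variable {n : Type*} [Fintype n] [DecidableEq n]

/-- The signed sum over permutations which, for a skew-symmetric matrix, is a multiple
(depending only on the size) of the Pfaffian. -/
def pfSum (A : Matrix (n ⊕ n) (n ⊕ n) ℝ) : ℝ :=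
  ∑ σ : Perm (n ⊕ n), ((Perm.sign σ : ℤ) : ℝ) * ∏ k, A (σ (Sum.inl k)) (σ (Sum.inr k))

theorem prod_sum_sum {n ι : Type*} [Fintype n] [DecidableEq n] [Fintype ι] (f : n → ι → ι → ℝ) :
    ∏ k, ∑ c, ∑ d, f k c d = ∑ q : n ⊕ n → ι, ∏ k, f k (q (Sum.inl k)) (q (Sum.inr k)) := by
  classical
  have h1 : ∀ k, ∑ c, ∑ d, f k c d = ∑ p : ι × ι, f k p.1 p.2 := fun k =>
    (Fintype.sum_prod_type (fun p : ι × ι => f k p.1 p.2)).symm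
  simp_rw [h1]
  rw [Finset.prod_univ_sum, Fintype.piFinset_univ]
  refine Fintype.sum_equiv ((Equiv.arrowProdEquivProdArrow n (fun _ => ι) (fun _ => ι)).trans
    (Equiv.sumArrowEquivProdArrow n n ι).symm) _ _ fun p => ?_
  rfl

/-- Expanding the entries gives a sum over all maps `q` of the index set of `det (P.submatrix id q)`
times a product of entries of `A`. A non-injective `q` repeats a column, and a permutation
contributes its sign times `det P`. -/
theorem pfSum_congruence (P A : Matrix (n ⊕ n) (n ⊕ n) ℝ) :
    pfSum (P * A * Pᵀ) = P.det * pfSum A := by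
  have h1 : ∀ a b, (P * A * Pᵀ) a b = ∑ c, ∑ d, P a c * A c d * P b d := by
    intro a b
    simp only [mul_apply, transpose_apply, Finset.sum_mul]
    rw [Finset.sum_comm]
  have h2 : pfSum (P * A * Pᵀ) = ∑ q : n ⊕ n → n ⊕ n,
      (P.submatrix id q).det * ∏ k, A (q (Sum.inl k)) (q (Sum.inr k)) := by
    unfold pfSum
    simp_rw [h1, prod_sum_sum, Finset.mul_sum]
    rw [Finset.sum_comm]
    refine Finset.sum_congr rfl fun q _ => ?_
    rw [det_apply', Finset.sum_mul]
    refine Finset.sum_congr rfl fun σ _ => ?_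
    rw [Fintype.prod_sum_type]
    simp only [submatrix_apply, id, Finset.prod_mul_distrib]
    ring
  rw [h2, pfSum, Finset.mul_sum]
  have h3 : ∀ σ : Perm (n ⊕ n), P.det * (((Perm.sign σ : ℤ) : ℝ) *
      ∏ k, A (σ (Sum.inl k)) (σ (Sum.inr k))) =
      (P.submatrix id (σ : n ⊕ n → n ⊕ n)).det * ∏ k, A (σ (Sum.inl k)) (σ (Sum.inr k)) := by
    intro σ
    rw [det_permute']
    ring
  simp_rw [h3]
  symm
  refine Fintype.sum_of_injective (fun σ : Perm (n ⊕ n) => (σ : n ⊕ n → n ⊕ n))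
    DFunLike.coe_injective _ _ (fun q hq => ?_) (fun σ => rfl)
  have hq' : ¬ Function.Injective q := fun h =>
    hq ⟨Equiv.ofBijective q (Finite.injective_iff_bijective.1 h), rfl⟩
  obtain ⟨i, j, hij, hne⟩ : ∃ i j, q i = q j ∧ i ≠ j := by
    unfold Function.Injective at hq'
    push Not at hq'
    exact hq'
  rw [det_zero_of_column_eq hne (fun k => by simp [hij]), zero_mul]

theorem pfSum_submatrix (ρ : Perm (n ⊕ n)) (A : Matrix (n ⊕ n) (n ⊕ n) ℝ) :
    pfSum (A.submatrix ρ ρ) = ((Perm.sign ρ : ℤ) : ℝ) * pfSum A := by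
  unfold pfSum
  rw [Finset.mul_sum]
  refine Fintype.sum_equiv (Equiv.mulLeft ρ) _ _ fun σ => ?_
  have h : (((Perm.sign ρ : ℤ) : ℝ)) * ((Perm.sign ρ : ℤ) : ℝ) = 1 := by
    rw [← Int.cast_mul, ← Units.val_mul, Int.units_mul_self]; simp
  simp only [Equiv.coe_mulLeft, Perm.sign_mul, Units.val_mul, Int.cast_mul, submatrix_apply,
    Perm.mul_apply]
  rw [← mul_assoc, ← mul_assoc, h, one_mul]

/-- The standard symplectic matrix. -/
def stdSymplectic (n : Type*) [DecidableEq n] : Matrix (n ⊕ n) (n ⊕ n) ℝ :=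
  fromBlocks 0 1 (-1) 0

/-- A nonvanishing term comes from a `σ` that permutes the pairs `{inl k, inr k}` and flips some of
them. Permuting the pairs is even, since it acts identically on two copies. Each flip contributes
`-1` to the sign and `-1` through the matrix entry, so no cancellation occurs. -/
theorem stdSymplectic_term (σ : Perm (n ⊕ n))
    (h : ∀ k, stdSymplectic n (σ (Sum.inl k)) (σ (Sum.inr k)) ≠ 0) :
    ((Perm.sign σ : ℤ) : ℝ) * ∏ k, stdSymplectic n (σ (Sum.inl k)) (σ (Sum.inr k)) = 1 := by
  have hs : ∀ k, σ (Sum.inr k) = (σ (Sum.inl k)).swap := by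
    intro k
    have := h k
    rcases h1 : σ (Sum.inl k) with i | i <;> rcases h2 : σ (Sum.inr k) with j | j <;>
      simp [stdSymplectic, h1, h2, Matrix.one_apply] at this ⊢ <;> exact this.symm
  let b : n → Bool := fun k => (σ (Sum.inl k)).isRight
  let r : n → n := fun k => (σ (Sum.inl k)).elim id id
  have hr : Function.Injective r := by
    intro k k' hkk
    rcases h1 : σ (Sum.inl k) with i | i <;> rcases h2 : σ (Sum.inl k') with j | j
    · have : i = j := by simpa [r, h1, h2] using hkk
      subst this
      exact Sum.inl_injective (σ.injective (h1.trans h2.symm))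
    · have : i = j := by simpa [r, h1, h2] using hkk
      subst this
      have h3 : σ (Sum.inr k) = σ (Sum.inl k') := by rw [hs, h1, h2]; rfl
      exact absurd (σ.injective h3) (by simp)
    · have : i = j := by simpa [r, h1, h2] using hkk
      subst this
      have h3 : σ (Sum.inr k) = σ (Sum.inl k') := by rw [hs, h1, h2]; rfl
      exact absurd (σ.injective h3) (by simp)
    · have : i = j := by simpa [r, h1, h2] using hkk
      subst this
      exact Sum.inl_injective (σ.injective (h1.trans h2.symm))
  let ρ : Perm n := Equiv.ofBijective r (Finite.injective_iff_bijective.1 hr)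
  let τ : Perm (n × Bool) := Equiv.prodCongrLeft (fun _ : Bool => ρ) *
    Equiv.prodCongrRight (fun k => if b k then Equiv.swap false true else 1)
  have hτ : Perm.sign τ = ∏ k, (if b k then (-1 : ℤˣ) else 1) := by
    simp only [τ, Perm.sign_mul, Perm.sign_prodCongrLeft, Perm.sign_prodCongrRight]
    rw [Fintype.prod_bool, Int.units_mul_self, one_mul]
    refine Finset.prod_congr rfl fun k _ => ?_
    split_ifs
    · exact Perm.sign_swap (by decide)
    · simp
  have hσ : Perm.sign σ = Perm.sign τ := by
    refine (Perm.sign_eq_sign_of_equiv τ σ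
      ((Equiv.prodComm n Bool).trans (Equiv.boolProdEquivSum n)) ?_).symm
    rintro ⟨k, c⟩
    rcases h1 : σ (Sum.inl k) with i | i <;> cases c <;>
      simp [τ, b, r, ρ, h1, hs, Equiv.boolProdEquivSum]
  rw [hσ, hτ, Units.coe_prod, Int.cast_prod, ← Finset.prod_mul_distrib]
  refine Finset.prod_eq_one fun k _ => ?_
  rcases h1 : σ (Sum.inl k) with i | i <;> simp [b, h1, hs, stdSymplectic]

theorem pfSum_stdSymplectic_pos : 0 < pfSum (stdSymplectic n) := by
  refine Finset.sum_pos' (fun σ _ => ?_) ⟨1, Finset.mem_univ _, ?_⟩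
  · by_cases h : ∀ k, stdSymplectic n (σ (Sum.inl k)) (σ (Sum.inr k)) ≠ 0
    · rw [stdSymplectic_term σ h]; exact zero_le_one
    · push Not at h
      obtain ⟨k, hk⟩ := h
      rw [Finset.prod_eq_zero (Finset.mem_univ k) hk, mul_zero]
  · rw [stdSymplectic_term 1 (fun k => by simp [stdSymplectic])]; exact zero_lt_one

/-- Symplectic Gram–Schmidt. As long as `2m` is less than the dimension, some nonzero `u` is
orthogonal to all the chosen vectors, and nondegeneracy supplies a partner for it. -/
theorem exists_partial_symplectic {ι : Type*} [Fintype ι] [DecidableEq ι] (A : Matrix ι ι ℝ)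
    (hA : Aᵀ = -A) (hdet : A.det ≠ 0) (m : ℕ) (hm : 2 * m ≤ Fintype.card ι) :
    ∃ e f : Fin m → ι → ℝ, (∀ i j, e i ⬝ᵥ A *ᵥ e j = 0) ∧ (∀ i j, f i ⬝ᵥ A *ᵥ f j = 0) ∧
      ∀ i j, e i ⬝ᵥ A *ᵥ f j = if i = j then 1 else 0 := by
  have skew : ∀ x y : ι → ℝ, x ⬝ᵥ A *ᵥ y = -(y ⬝ᵥ A *ᵥ x) := by
    intro x y
    rw [dotProduct_mulVec, ← mulVec_transpose, hA, neg_mulVec, neg_dotProduct, dotProduct_comm]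
  have alt : ∀ x : ι → ℝ, x ⬝ᵥ A *ᵥ x = 0 := fun x => by linarith [skew x x]
  induction m with
  | zero => exact ⟨Fin.elim0, Fin.elim0, fun i => i.elim0, fun i => i.elim0, fun i => i.elim0⟩
  | succ m ih =>
    obtain ⟨e, f, hee, hff, hef⟩ := ih (by omega)
    have hfe : ∀ i j, f i ⬝ᵥ A *ᵥ e j = -(if i = j then 1 else 0) := fun i j => by
      rw [skew, hef]; simp [eq_comm]
    let T : (ι → ℝ) →ₗ[ℝ] (Fin m ⊕ Fin m → ℝ) :=
      LinearMap.pi fun a => (dotProductBilin ℝ ℝ (Sum.elim e f a)) ∘ₗ A.mulVecLin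
    have hT : ∀ x a, T x a = Sum.elim e f a ⬝ᵥ A *ᵥ x := fun x a => rfl
    obtain ⟨u, hu, hu0⟩ : ∃ u, T u = 0 ∧ u ≠ 0 := by
      have : ¬ Function.Injective T := fun hinj => by
        have := LinearMap.finrank_le_finrank_of_injective hinj
        simp at this
        omega
      rw [← LinearMap.ker_eq_bot, Submodule.eq_bot_iff] at this
      push Not at this
      obtain ⟨u, hu, hu0⟩ := this
      exact ⟨u, hu, hu0⟩
    have hue : ∀ i, e i ⬝ᵥ A *ᵥ u = 0 := fun i => by
      have := congrFun hu (Sum.inl i); rwa [hT] at this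
    have huf : ∀ i, f i ⬝ᵥ A *ᵥ u = 0 := fun i => by
      have := congrFun hu (Sum.inr i); rwa [hT] at this
    have hue' : ∀ i, u ⬝ᵥ A *ᵥ e i = 0 := fun i => by rw [skew, hue, neg_zero]
    have huf' : ∀ i, u ⬝ᵥ A *ᵥ f i = 0 := fun i => by rw [skew, huf, neg_zero]
    obtain ⟨w, hw⟩ : ∃ w, u ⬝ᵥ A *ᵥ w = 1 := by
      have h1 : u ᵥ* A ≠ 0 := fun h => hu0 (eq_zero_of_vecMul_eq_zero hdet h)
      obtain ⟨i, hi⟩ := Function.ne_iff.1 h1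
      refine ⟨Pi.single i ((u ᵥ* A) i)⁻¹, ?_⟩
      rw [dotProduct_mulVec, dotProduct_single]
      exact mul_inv_cancel₀ hi
    -- The partner `w` is corrected by its components along the earlier pairs. The pairing with `u`
    -- is unchanged because `u` is orthogonal to those pairs.
    let v : ι → ℝ := w - ∑ j, (w ⬝ᵥ A *ᵥ f j) • e j + ∑ j, (w ⬝ᵥ A *ᵥ e j) • f j
    have hvx : ∀ x, v ⬝ᵥ A *ᵥ x = w ⬝ᵥ A *ᵥ x - ∑ j, (w ⬝ᵥ A *ᵥ f j) * (e j ⬝ᵥ A *ᵥ x)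
        + ∑ j, (w ⬝ᵥ A *ᵥ e j) * (f j ⬝ᵥ A *ᵥ x) := by
      intro x
      simp only [v, add_dotProduct, sub_dotProduct, sum_dotProduct, smul_dotProduct, smul_eq_mul]
    have hve : ∀ k, v ⬝ᵥ A *ᵥ e k = 0 := by
      intro k; rw [hvx]; simp [hee, hfe]
    have hvf : ∀ k, v ⬝ᵥ A *ᵥ f k = 0 := by
      intro k; rw [hvx]; simp [hff, hef]
    have hvu : v ⬝ᵥ A *ᵥ u = -1 := by
      rw [hvx, skew w u, hw]; simp [hue, huf]
    refine ⟨Fin.cons u e, Fin.cons v f, ?_, ?_, ?_⟩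
    · intro i j
      refine Fin.cases ?_ (fun i => ?_) i <;> refine Fin.cases ?_ (fun j => ?_) j <;>
        simp [alt, hee, hue, hue']
    · intro i j
      refine Fin.cases ?_ (fun i => ?_) i <;> refine Fin.cases ?_ (fun j => ?_) j <;>
        simp [alt, hff, hvf]
      rw [skew, hvf, neg_zero]
    · intro i j
      refine Fin.cases ?_ (fun i => ?_) i <;> refine Fin.cases ?_ (fun j => ?_) j <;>
        simp [hef, huf', Fin.succ_ne_zero, (Fin.succ_ne_zero _).symm]
      · rw [skew, hvu, neg_neg]
      · rw [skew, hve, neg_zero]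

/-- A kernel vector is made a row of an invertible `P`. Then `P A Pᵀ` has a zero row and a zero
column at the same index, and every term of `pfSum` contains an entry from one of them. -/
theorem pfSum_eq_zero_of_det_eq_zero (A : Matrix (n ⊕ n) (n ⊕ n) ℝ) (hdet : A.det = 0)
    (hA : Aᵀ = -A) : pfSum A = 0 := by
  obtain ⟨v, hv0, hv⟩ := exists_mulVec_eq_zero_iff.2 hdet
  obtain ⟨i, hi⟩ := Function.ne_iff.1 hv0
  let P : Matrix (n ⊕ n) (n ⊕ n) ℝ := (1 : Matrix (n ⊕ n) (n ⊕ n) ℝ).updateRow i v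
  have hP : P.det ≠ 0 := by
    have h1 : v = ∑ j, v j • (1 : Matrix (n ⊕ n) (n ⊕ n) ℝ) j := by
      ext k; simp [Finset.sum_apply, Matrix.one_apply]
    have h2 : P.det = v i := by
      simp only [P]
      rw [← cramer_transpose_apply]
      simp
    rw [h2]; exact hi
  have hvA : v ᵥ* A = 0 := by
    rw [← mulVec_transpose, hA, neg_mulVec, hv, neg_zero]
  have hrow : ∀ b, (P * A * Pᵀ) i b = 0 := by
    intro b
    have : (P * A) i = 0 := by
      rw [← hvA]; ext c; simp [P, mul_apply, vecMul, dotProduct]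
    rw [mul_apply]
    exact Finset.sum_eq_zero fun c _ => by rw [congrFun this c]; simp
  have hcol : ∀ b, (P * A * Pᵀ) b i = 0 := by
    intro b
    have : (P * A * Pᵀ)ᵀ = -(P * A * Pᵀ) := by
      simp [transpose_mul, hA, mul_assoc]
    have h2 := congrFun (congrFun this i) b
    rw [transpose_apply, Matrix.neg_apply, hrow, neg_zero] at h2
    exact h2
  have h0 : pfSum (P * A * Pᵀ) = 0 := by
    refine Finset.sum_eq_zero fun σ _ => ?_
    rcases h1 : σ.symm i with k | k
    · have : σ (Sum.inl k) = i := by rw [← h1]; simp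
      rw [Finset.prod_eq_zero (Finset.mem_univ k) (by rw [this]; exact hrow _), mul_zero]
    · have : σ (Sum.inr k) = i := by rw [← h1]; simp
      rw [Finset.prod_eq_zero (Finset.mem_univ k) (by rw [this]; exact hcol _), mul_zero]
  rw [pfSum_congruence] at h0
  exact (mul_eq_zero.1 h0).resolve_left hP

/-- For skew-symmetric matrices of a fixed even size, the determinant is proportional to the
square of `pfSum`. -/
theorem exists_pfSum_sq (n : ℕ) : ∃ K : ℝ, 0 < K ∧
    ∀ A : Matrix (Fin n ⊕ Fin n) (Fin n ⊕ Fin n) ℝ, Aᵀ = -A → pfSum A ^ 2 = K * A.det := by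
  have hJ : (stdSymplectic (Fin n)).det = 1 := by
    have h4 : (fromBlocks (1 : Matrix (Fin n) (Fin n) ℝ) (-1) 0 1) * stdSymplectic (Fin n) =
        fromBlocks 1 1 (-1) 0 := by simp [stdSymplectic, fromBlocks_multiply]
    have h5 := congrArg Matrix.det h4
    rw [det_mul, det_fromBlocks_zero₂₁, det_fromBlocks_one₁₁] at h5
    simpa using h5
  -- The constant is read off at the standard symplectic matrix `J`, of determinant `1`. If `P A Pᵀ
  -- = J`, then `det P ^ 2 * det A = 1` and `pfSum J = det P * pfSum A`.
  refine ⟨pfSum (stdSymplectic (Fin n)) ^ 2, by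
    have := pfSum_stdSymplectic_pos (n := Fin n); positivity, fun A hA => ?_⟩
  by_cases hdet : A.det = 0
  · rw [pfSum_eq_zero_of_det_eq_zero A hdet hA, hdet]; simp
  obtain ⟨e, f, hee, hff, hef⟩ := exists_partial_symplectic A hA hdet n (by simp; omega)
  let P : Matrix (Fin n ⊕ Fin n) (Fin n ⊕ Fin n) ℝ := Matrix.of (Sum.elim e f)
  have hP : P * A * Pᵀ = stdSymplectic (Fin n) := by
    have h : ∀ a b, (P * A * Pᵀ) a b = P a ⬝ᵥ A *ᵥ P b := by
      intro a b
      rw [dotProduct_mulVec]; rfl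
    have skew : (P * A * Pᵀ)ᵀ = -(P * A * Pᵀ) := by
      simp [transpose_mul, hA, mul_assoc]
    ext (i | i) (j | j)
    · rw [h]; exact hee i j
    · rw [h]; exact (hef i j).trans (by simp [stdSymplectic, Matrix.one_apply])
    · have := congrFun (congrFun skew (Sum.inl j)) (Sum.inr i)
      rw [transpose_apply] at this
      rw [this, Matrix.neg_apply, h]
      refine (congrArg Neg.neg (hef j i)).trans ?_
      simp [stdSymplectic, Matrix.one_apply, eq_comm]
    · rw [h]; exact hff i j
  have h1 : P.det * A.det * P.det = 1 := by
    rw [← hJ, ← hP, det_mul, det_mul, det_transpose]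
  have h2 : pfSum (stdSymplectic (Fin n)) = P.det * pfSum A := by
    rw [← hP, pfSum_congruence]
  rw [h2]
  linear_combination (-(pfSum A ^ 2)) * h1

end Pfaffian

/-! ### The sign matrix and the Vandermonde determinant -/

section SignMatrix

/-- The matrix `sign (x_i - x_j)`. -/
noncomputable def signMatrix {ι : Type*} (x : ι → ℝ) : Matrix ι ι ℝ :=
  Matrix.of fun i j => Real.sign (x i - x j)

theorem signMatrix_transpose {ι : Type*} (x : ι → ℝ) : (signMatrix x)ᵀ = -signMatrix x := by
  ext i j
  simp only [signMatrix, transpose_apply, of_apply, Matrix.neg_apply]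
  rw [← Real.sign_neg, neg_sub]

/-- The determinant is an odd integer. Modulo 2 the matrix is `O - 1` with `O` the all-ones matrix,
and in even size `O * O = 0`, so `O - 1` is its own inverse. -/
theorem signMatrix_det_ne_zero {ι : Type*} [Fintype ι] [DecidableEq ι] (x : ι → ℝ)
    (hx : Function.Injective x) (hι : Even (Fintype.card ι)) : (signMatrix x).det ≠ 0 := by
  let S : Matrix ι ι ℤ := Matrix.of fun i j => if i = j then 0 else if x j < x i then 1 else -1
  have hS : signMatrix x = S.map (Int.castRingHom ℝ) := by
    ext i j
    simp only [signMatrix, S, of_apply, map_apply]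
    by_cases h : i = j
    · simp [h]
    · rcases lt_or_gt_of_ne (fun e => h (hx e)) with h1 | h1
      · rw [Real.sign_of_neg (by linarith)]; simp [h, h1.not_gt]
      · rw [Real.sign_of_pos (by linarith)]; simp [h, h1]
  let O : Matrix ι ι (ZMod 2) := Matrix.of fun _ _ => 1
  have hmod : S.map (Int.castRingHom (ZMod 2)) = O - 1 := by
    ext i j
    simp only [S, O, of_apply, map_apply, Matrix.sub_apply, Matrix.one_apply]
    split_ifs <;> simp
  have hOO : O * O = 0 := by
    ext i j
    have : ((Fintype.card ι : ℕ) : ZMod 2) = 0 := (ZMod.natCast_eq_zero_iff_even).2 hι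
    simp [O, mul_apply, this]
  have hsq : (O - 1) * (O - 1) = 1 := by
    have h2 : O + O = 0 := by ext i j; simp [O]; decide
    have : (O - 1) * (O - 1) = O * O - (O + O) + 1 := by noncomm_ring
    rw [this, hOO, h2]; simp
  have h1 : (Int.castRingHom (ZMod 2)) S.det ≠ 0 := by
    rw [RingHom.map_det, RingHom.mapMatrix_apply, hmod]
    intro h0
    have := congrArg Matrix.det hsq
    rw [det_mul, h0] at this
    simp at this
  rw [hS, ← RingHom.mapMatrix_apply, ← RingHom.map_det]
  intro h0
  have : S.det = 0 := by simpa using h0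
  rw [this] at h1
  simp at h1

theorem det_vandermonde_pos {N : ℕ} {x : Fin N → ℝ} (hx : StrictMono x) :
    0 < (vandermonde x).det := by
  rw [det_vandermonde]
  refine Finset.prod_pos fun i _ => Finset.prod_pos fun j hj => ?_
  have := hx (Finset.mem_Ioi.1 hj)
  linarith

theorem det_vandermonde_comp {N : ℕ} (x : Fin N → ℝ) (σ : Perm (Fin N)) :
    (vandermonde (x ∘ σ)).det = ((Perm.sign σ : ℤ) : ℝ) * (vandermonde x).det := by
  rw [← det_permute]; rfl

theorem exists_strictMono_comp {N : ℕ} {x : Fin N → ℝ} (hx : Function.Injective x) :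
    ∃ σ : Perm (Fin N), StrictMono (x ∘ σ) :=
  ⟨Tuple.sort x, (Tuple.monotone_sort x).strictMono_of_injective
    (hx.comp (Tuple.sort x).injective)⟩

/-- The pairs indexing the rows of a matrix of even size. -/
def pairEquiv (n : ℕ) : Fin n ⊕ Fin n ≃ Fin (2 * n) :=
  finSumFinEquiv.trans (finCongr (two_mul n).symm)

/-- Permuting the coordinates of `x` multiplies both factors by the sign of the permutation, so `x`
may be taken increasing. Then the sign matrix no longer depends on `x`, and `κ` is its `pfSum`,
nonzero because its square is a positive multiple of a nonzero determinant. If two coordinates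
coincide, both sides vanish. -/
theorem exists_pfSum_signMatrix (n : ℕ) : ∃ κ : ℝ, κ ≠ 0 ∧ ∀ x : Fin (2 * n) → ℝ,
    pfSum (signMatrix (x ∘ pairEquiv n)) * (vandermonde x).det = κ * |(vandermonde x).det| := by
  obtain ⟨K, hK, hKA⟩ := exists_pfSum_sq n
  let x₀ : Fin (2 * n) → ℝ := fun i => (i : ℕ)
  have hx₀ : StrictMono x₀ := fun i j h => by simpa [x₀] using h
  refine ⟨pfSum (signMatrix (x₀ ∘ pairEquiv n)), ?_, fun x => ?_⟩
  · intro h0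
    have h1 := hKA _ (signMatrix_transpose (x₀ ∘ pairEquiv n))
    rw [h0] at h1
    have := signMatrix_det_ne_zero (x₀ ∘ pairEquiv n)
      (hx₀.injective.comp (pairEquiv n).injective) (by simp)
    have h2 : K * (signMatrix (x₀ ∘ pairEquiv n)).det ≠ 0 := mul_ne_zero hK.ne' this
    exact h2 (by rw [← h1]; ring)
  · by_cases hx : Function.Injective x
    · obtain ⟨σ, hσ⟩ := exists_strictMono_comp hx
      let ρ : Perm (Fin n ⊕ Fin n) := (pairEquiv n).symm.permCongr σ
      have h1 : signMatrix (x₀ ∘ pairEquiv n) = (signMatrix (x ∘ pairEquiv n)).submatrix ρ ρ := by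
        ext a b
        have hρ : ∀ a, x (pairEquiv n (ρ a)) = (x ∘ σ) (pairEquiv n a) := fun a => by
          simp [ρ, Equiv.permCongr_apply]
        simp only [signMatrix, of_apply, submatrix_apply, Function.comp_apply (f := x)
          (g := pairEquiv n), hρ, Function.comp_apply (f := x₀)]
        rcases lt_trichotomy (pairEquiv n a) (pairEquiv n b) with h | h | h
        · rw [Real.sign_of_neg (sub_neg.2 (hx₀ h)), Real.sign_of_neg (sub_neg.2 (hσ h))]
        · rw [h, sub_self, sub_self]
        · rw [Real.sign_of_pos (sub_pos.2 (hx₀ h)), Real.sign_of_pos (sub_pos.2 (hσ h))]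
      have hs : Perm.sign ρ = Perm.sign σ := Perm.sign_permCongr _ _
      rw [h1, pfSum_submatrix, hs]
      have h2 := det_vandermonde_pos hσ
      rw [det_vandermonde_comp] at h2
      have h3 : |(vandermonde x).det| = ((Perm.sign σ : ℤ) : ℝ) * (vandermonde x).det := by
        rw [← abs_of_pos h2, abs_mul]
        rcases Int.units_eq_one_or (Perm.sign σ) with h | h <;> simp [h]
      have h4 : ((Perm.sign σ : ℤ) : ℝ) * ((Perm.sign σ : ℤ) : ℝ) = 1 := by
        rw [← Int.cast_mul, ← Units.val_mul, Int.units_mul_self]; simp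
      rw [h3]
      linear_combination (-(pfSum (signMatrix (x ∘ pairEquiv n)) * (vandermonde x).det)) * h4
    · have : (vandermonde x).det = 0 := by
        by_contra h
        exact hx (det_vandermonde_ne_zero_iff.1 h)
      rw [this]; simp

end SignMatrix

/-! ### Andréief's identity for the tau functions -/

section Moments

/-- The one-variable weight `exp (V(x) + ∑ t_i x^i)`. -/
noncomputable def lineWeight (V : ℝ → ℝ) (t : ℕ+ → ℝ) (x : ℝ) : ℝ :=
  Real.exp (V x + ∑' i : ℕ+, t i * x ^ (i : ℕ))

/-- Separate summability is needed to split the series, as `tsum` takes a default value on divergent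
families. Hence the factorization is available only almost everywhere on `E × E`. -/
theorem skewWeight_eq (V : ℝ → ℝ) (t s : ℕ+ → ℝ) {x y : ℝ}
    (hx : Summable fun i : ℕ+ => t i * x ^ (i : ℕ))
    (hy : Summable fun i : ℕ+ => (-s) i * y ^ (i : ℕ)) :
    skewWeight V t s x y = lineWeight V t x * lineWeight V (-s) y * Real.sign (x - y) := by
  unfold skewWeight lineWeight
  rw [← Real.exp_add]
  congr 2
  have : ∑' i : ℕ+, (t i * x ^ (i : ℕ) - s i * y ^ (i : ℕ)) =
      ∑' i : ℕ+, t i * x ^ (i : ℕ) + ∑' i : ℕ+, (-s) i * y ^ (i : ℕ) := by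
    rw [← hx.tsum_add hy]
    exact tsum_congr fun i => by simp; ring
  rw [this]; ring

theorem measurable_sign : Measurable Real.sign := by
  unfold Real.sign
  exact Measurable.ite measurableSet_Iio measurable_const
    (Measurable.ite measurableSet_Ioi measurable_const measurable_const)

theorem abs_sign_le_one (x : ℝ) : |Real.sign x| ≤ 1 := by
  rcases Real.sign_apply_eq x with h | h | h <;> rw [h] <;> norm_num

variable {V : ℝ → ℝ} {E : Set ℝ} {l : ℕ} {t s : ℕ+ → ℝ}

theorem skewWeight_ae_eq (ht : Converges V E l t) (hs : Converges V E l (-s)) :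
    ∀ᵐ p ∂((volume.restrict E).prod (volume.restrict E)), skewWeight V t s p.1 p.2 =
      lineWeight V t p.1 * lineWeight V (-s) p.2 * Real.sign (p.1 - p.2) := by
  have h1 := Measure.quasiMeasurePreserving_fst (μ := volume.restrict E) (ν := volume.restrict E)
    |>.ae ht.1
  have h2 := Measure.quasiMeasurePreserving_snd (μ := volume.restrict E) (ν := volume.restrict E)
    |>.ae hs.1
  filter_upwards [h1, h2] with p hp hq
  exact skewWeight_eq V t s hp hq

theorem integrable_moment (ht : Converges V E l t) (hs : Converges V E l (-s)) {i j : ℕ}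
    (hi : i < l) (hj : j < l) :
    Integrable (fun p : ℝ × ℝ => p.1 ^ i * p.2 ^ j * skewWeight V t s p.1 p.2)
      ((volume.restrict E).prod (volume.restrict E)) := by
  have h1 := (ht.2 i hi).integrable.mul_prod (hs.2 j hj).integrable
  have h2 : Integrable (fun p : ℝ × ℝ => Real.sign (p.1 - p.2) *
      ((p.1 ^ i * lineWeight V t p.1) * (p.2 ^ j * lineWeight V (-s) p.2)))
      ((volume.restrict E).prod (volume.restrict E)) := by
    refine h1.bdd_mul (c := 1) ?_ ?_
    · exact (measurable_sign.comp (measurable_fst.sub measurable_snd)).aestronglyMeasurable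
    · exact Filter.Eventually.of_forall fun p => abs_sign_le_one _
  refine h2.congr ?_
  filter_upwards [skewWeight_ae_eq ht hs] with p hp
  rw [hp]; ring

theorem moment_eq (V : ℝ → ℝ) (E : Set ℝ) (t s : ℕ+ → ℝ) (i j : ℕ) :
    moment V E t s i j = ∫ p, p.1 ^ i * p.2 ^ j * skewWeight V t s p.1 p.2
      ∂((volume.restrict E).prod (volume.restrict E)) := by
  rw [moment, Measure.volume_eq_prod, ← Measure.prod_restrict]

/-- Expansion of the integrand of the multiple integral into products of functions of the pairs
`(x_k, y_k)`. -/
theorem multiIntegrand_eq (V : ℝ → ℝ) (t s : ℕ+ → ℝ) (l : ℕ) (x y : Fin l → ℝ) :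
    multiIntegrand V t s l x y = ∑ σ : Perm (Fin l), ∑ τ : Perm (Fin l),
      (((Perm.sign σ : ℤ) : ℝ) * ((Perm.sign τ : ℤ) : ℝ)) *
        ∏ k, (x k ^ (σ k : ℕ) * y k ^ (τ k : ℕ) * skewWeight V t s (x k) (y k)) := by
  have h : ∀ z : Fin l → ℝ, (vandermonde z).det =
      ∑ σ : Perm (Fin l), ((Perm.sign σ : ℤ) : ℝ) * ∏ k, z k ^ (σ k : ℕ) := by
    intro z
    rw [← det_transpose, det_apply']
    rfl
  rw [multiIntegrand, h, h, mul_assoc, Finset.sum_mul_sum, Finset.mul_sum]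
  refine Finset.sum_congr rfl fun σ _ => ?_
  rw [Finset.mul_sum]
  refine Finset.sum_congr rfl fun τ _ => ?_
  simp only [Finset.prod_mul_distrib]
  ring

theorem volume_restrict_box (E : Set ℝ) (l : ℕ) :
    (volume : Measure ((Fin l → ℝ) × (Fin l → ℝ))).restrict (box E l) =
      (Measure.pi fun _ => volume.restrict E).prod (Measure.pi fun _ => volume.restrict E) := by
  rw [box, Measure.volume_eq_prod, ← Measure.prod_restrict, volume_pi, Measure.restrict_pi_pi]

/-- Fubini, after regrouping a pair of tuples `(x, y)` as a tuple of pairs `(x_k, y_k)`. -/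
theorem integral_prod_pairs {ι : Type*} [Fintype ι] {μ : Measure ℝ} [SigmaFinite μ]
    {f : ι → ℝ × ℝ → ℝ} (hf : ∀ k, Integrable (f k) (μ.prod μ)) :
    Integrable (fun p : (ι → ℝ) × (ι → ℝ) => ∏ k, f k (p.1 k, p.2 k))
        ((Measure.pi fun _ => μ).prod (Measure.pi fun _ => μ)) ∧
      ∫ p, ∏ k, f k (p.1 k, p.2 k) ∂((Measure.pi fun _ : ι => μ).prod (Measure.pi fun _ => μ)) =
        ∏ k, ∫ q, f k q ∂(μ.prod μ) := by
  have hmp := measurePreserving_arrowProdEquivProdArrow ℝ ℝ ι (fun _ => μ) (fun _ => μ)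
  have h1 : Integrable (fun p : ι → ℝ × ℝ => ∏ k, f k (p k)) (Measure.pi fun _ => μ.prod μ) :=
    Integrable.fintype_prod_dep hf
  constructor
  · rw [← hmp.integrable_comp_emb (MeasurableEquiv.measurableEmbedding _)]
    exact h1
  · rw [← hmp.integral_comp' (g := fun p : (ι → ℝ) × (ι → ℝ) => ∏ k, f k (p.1 k, p.2 k))]
    exact integral_fintype_prod_eq_prod f

/-- The two descriptions of the tau functions. -/
theorem tau_eq_integral (ht : Converges V E l t) (hs : Converges V E l (-s)) :
    IntegrableOn (fun p : (Fin l → ℝ) × (Fin l → ℝ) => multiIntegrand V t s l p.1 p.2)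
        (box E l) ∧
      (l.factorial : ℝ) * tau V E l t s = ∫ p in box E l, multiIntegrand V t s l p.1 p.2 := by
  have key := fun σ τ : Perm (Fin l) => integral_prod_pairs (ι := Fin l) (μ := volume.restrict E)
    (f := fun k p => p.1 ^ (σ k : ℕ) * p.2 ^ (τ k : ℕ) * skewWeight V t s p.1 p.2)
    (fun k => integrable_moment ht hs (σ k).2 (τ k).2)
  have hint := fun σ τ : Perm (Fin l) =>
    (key σ τ).1.const_mul (((Perm.sign σ : ℤ) : ℝ) * ((Perm.sign τ : ℤ) : ℝ))
  rw [IntegrableOn, volume_restrict_box]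
  simp_rw [multiIntegrand_eq]
  refine ⟨integrable_finsetSum _ fun σ _ => integrable_finsetSum _ fun τ _ => hint σ τ, ?_⟩
  rw [integral_finsetSum _ fun σ _ => integrable_finsetSum _ fun τ _ => hint σ τ]
  have h1 : ∀ σ : Perm (Fin l), ∫ p : (Fin l → ℝ) × (Fin l → ℝ), (∑ τ : Perm (Fin l),
      (((Perm.sign σ : ℤ) : ℝ) * ((Perm.sign τ : ℤ) : ℝ)) *
        ∏ k, (p.1 k ^ (σ k : ℕ) * p.2 k ^ (τ k : ℕ) * skewWeight V t s (p.1 k) (p.2 k)))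
        ∂((Measure.pi fun _ => volume.restrict E).prod (Measure.pi fun _ => volume.restrict E)) =
      tau V E l t s := by
    intro σ
    rw [integral_finsetSum _ fun τ _ => hint σ τ]
    simp_rw [integral_const_mul]
    rw [tau, ← det_transpose, det_apply']
    -- With `σ` fixed, the substitution `τ ↦ τ σ⁻¹` gives the Leibniz expansion of the determinant.
    -- The result does not depend on `σ`, whence the factor `l !`.
    refine Fintype.sum_equiv (Equiv.mulRight σ⁻¹) _ _ fun τ => ?_
    rw [(key σ τ).2]
    simp only [← moment_eq, Equiv.coe_mulRight, Perm.sign_mul, Perm.sign_inv, Units.val_mul,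
      Int.cast_mul, transpose_apply, of_apply]
    have h := Equiv.prod_comp σ (fun i => moment V E t s i (τ (σ.symm i)))
    simp only [Equiv.symm_apply_apply] at h
    rw [mul_comm ((Perm.sign σ : ℤ) : ℝ), h]
    rfl
  rw [Finset.sum_congr rfl fun σ _ => h1 σ]
  simp [Fintype.card_perm]

end Moments

/-! ### De Bruijn's formula and the eigenvalue integral -/

section DeBruijn

theorem integral_prod_paired {ι κ : Type*} [Fintype ι] [Fintype κ] (e : ι ⊕ ι ≃ κ) {μ : Measure ℝ}
    [SigmaFinite μ] {f : ι → ℝ × ℝ → ℝ} (hf : ∀ k, Integrable (f k) (μ.prod μ)) :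
    Integrable (fun x : κ → ℝ => ∏ k, f k (x (e (Sum.inl k)), x (e (Sum.inr k))))
        (Measure.pi fun _ => μ) ∧
      ∫ x, ∏ k, f k (x (e (Sum.inl k)), x (e (Sum.inr k))) ∂(Measure.pi fun _ : κ => μ) =
        ∏ k, ∫ q, f k q ∂(μ.prod μ) := by
  have h1 := measurePreserving_piCongrLeft (fun _ : κ => μ) e
  have h2 := measurePreserving_sumPiEquivProdPi (X := fun _ : ι ⊕ ι => ℝ) (fun _ => μ)
  have h3 := integral_prod_pairs hf
  have h4 : ∀ y : ι ⊕ ι → ℝ, ∀ a,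
      (MeasurableEquiv.piCongrLeft (fun _ : κ => ℝ) e y) (e a) = y a := fun y a =>
    MeasurableEquiv.piCongrLeft_apply_apply (β := fun _ => ℝ) e y a
  constructor
  · rw [← h1.integrable_comp_emb (MeasurableEquiv.measurableEmbedding _)]
    simp only [Function.comp_def, h4]
    exact (h2.integrable_comp_emb (MeasurableEquiv.measurableEmbedding _)).2 h3.1
  · rw [← h1.integral_comp', ← h3.2, ← h2.integral_comp']
    simp only [h4]
    rfl

variable {V : ℝ → ℝ} {E : Set ℝ} {n : ℕ} {t : ℕ+ → ℝ}

theorem integrable_skew {l : ℕ} (ht : Converges V E l t) {i j : ℕ} (hi : i < l) (hj : j < l) :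
    Integrable (fun p : ℝ × ℝ => p.1 ^ i * p.2 ^ j *
        (lineWeight V t p.1 * lineWeight V t p.2 * Real.sign (p.1 - p.2)))
        ((volume.restrict E).prod (volume.restrict E)) ∧
      ∫ p, p.1 ^ i * p.2 ^ j * (lineWeight V t p.1 * lineWeight V t p.2 * Real.sign (p.1 - p.2))
        ∂((volume.restrict E).prod (volume.restrict E)) = moment V E t (-t) i j := by
  have ht' : Converges V E l (- -t) := by rwa [neg_neg]
  have h := skewWeight_ae_eq ht ht'
  rw [neg_neg] at h
  have h' : (fun p : ℝ × ℝ => p.1 ^ i * p.2 ^ j * skewWeight V t (-t) p.1 p.2) =ᵐ[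
      (volume.restrict E).prod (volume.restrict E)] fun p : ℝ × ℝ => p.1 ^ i * p.2 ^ j *
        (lineWeight V t p.1 * lineWeight V t p.2 * Real.sign (p.1 - p.2)) := by
    filter_upwards [h] with p hp
    rw [hp]
  refine ⟨(integrable_moment ht ht' hi hj).congr h', ?_⟩
  rw [moment_eq, integral_congr_ae h']

/-- Exchanging the two variables changes only the sign of `ε(x - y)`, because at `s = -t` both
variables carry the same weight. -/
theorem moment_skew {l : ℕ} (ht : Converges V E l t) {i j : ℕ} (hi : i < l) (hj : j < l) :
    moment V E t (-t) j i = -moment V E t (-t) i j := by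
  rw [← (integrable_skew ht hi hj).2, ← (integrable_skew ht hj hi).2, ← integral_neg,
    ← integral_prod_swap]
  refine integral_congr_ae (Filter.Eventually.of_forall fun p => ?_)
  simp only [Prod.fst_swap, Prod.snd_swap]
  rw [← neg_sub p.1 p.2, Real.sign_neg]
  ring

theorem det_vandermonde_eq_sum {n : ℕ} (x : Fin (2 * n) → ℝ) :
    (vandermonde x).det = ∑ π : Perm (Fin n ⊕ Fin n), ((Perm.sign π : ℤ) : ℝ) *
      ∏ a, x (pairEquiv n a) ^ (pairEquiv n (π a) : ℕ) := by
  rw [← det_submatrix_equiv_self (pairEquiv n), ← det_transpose, det_apply']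
  rfl

theorem integrable_vandermonde (ht : Converges V E (2 * n) t) :
    Integrable (fun x : Fin (2 * n) → ℝ => |(vandermonde x).det| * ∏ i, lineWeight V t (x i))
      (Measure.pi fun _ => volume.restrict E) := by
  have h1 : Integrable (fun x : Fin (2 * n) → ℝ =>
      (vandermonde x).det * ∏ i, lineWeight V t (x i)) (Measure.pi fun _ => volume.restrict E) := by
    have : ∀ x : Fin (2 * n) → ℝ, (vandermonde x).det * ∏ i, lineWeight V t (x i) =
        ∑ π : Perm (Fin (2 * n)), ((Perm.sign π : ℤ) : ℝ) *
          ∏ i, (x i ^ (π i : ℕ) * lineWeight V t (x i)) := by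
      intro x
      rw [← det_transpose, det_apply', Finset.sum_mul]
      refine Finset.sum_congr rfl fun π _ => ?_
      rw [Finset.prod_mul_distrib, mul_assoc]
      rfl
    simp_rw [this]
    refine integrable_finsetSum _ fun π _ => Integrable.const_mul ?_ _
    exact Integrable.fintype_prod_dep
      (f := fun i x => x ^ (π i : ℕ) * lineWeight V t x) fun i => (ht.2 _ (π i).2).integrable
  refine h1.norm.congr (Filter.Eventually.of_forall fun x => ?_)
  simp only [norm_mul, Real.norm_eq_abs]
  congr 1
  exact abs_of_nonneg (Finset.prod_nonneg fun i _ => (Real.exp_pos _).le)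

/-- Let `σ` index the expansion of `pfSum` and `π` that of the Vandermonde determinant. The factors
`ε` pair the coordinates according to `σ`, and the coordinate `σ a` carries the exponent `π (σ a)`.
Each term is thus a product of double integrals, that is, of moments indexed by `π * σ`. -/
theorem pfSum_moments (ht : Converges V E (2 * n) t) :
    ∫ x : Fin (2 * n) → ℝ, pfSum (signMatrix (x ∘ pairEquiv n)) * (vandermonde x).det *
        ∏ i, lineWeight V t (x i) ∂(Measure.pi fun _ => volume.restrict E) =
      ((2 * n).factorial : ℝ) *
        pfSum (Matrix.of fun a b => moment V E t (-t) (pairEquiv n a) (pairEquiv n b)) := by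
  let g : Perm (Fin n ⊕ Fin n) → Fin n → ℝ × ℝ → ℝ := fun ρ k p =>
    p.1 ^ (pairEquiv n (ρ (Sum.inl k)) : ℕ) * p.2 ^ (pairEquiv n (ρ (Sum.inr k)) : ℕ) *
        (lineWeight V t p.1 * lineWeight V t p.2 * Real.sign (p.1 - p.2))
  have hg : ∀ ρ k, Integrable (g ρ k) ((volume.restrict E).prod (volume.restrict E)) := fun ρ k =>
    (integrable_skew ht (Fin.is_lt _) (Fin.is_lt _)).1
  have key := fun σ π : Perm (Fin n ⊕ Fin n) => integral_prod_paired (σ.trans (pairEquiv n))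
    (hg (π * σ))
  have hexp : ∀ x : Fin (2 * n) → ℝ, pfSum (signMatrix (x ∘ pairEquiv n)) * (vandermonde x).det *
      ∏ i, lineWeight V t (x i) = ∑ σ : Perm (Fin n ⊕ Fin n), ∑ π : Perm (Fin n ⊕ Fin n),
        ((Perm.sign (π * σ) : ℤ) : ℝ) * ∏ k, g (π * σ) k
          (x ((σ.trans (pairEquiv n)) (Sum.inl k)), x ((σ.trans (pairEquiv n)) (Sum.inr k))) := by
    intro x
    rw [det_vandermonde_eq_sum, pfSum, Finset.sum_mul_sum, Finset.sum_mul]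
    refine Finset.sum_congr rfl fun σ _ => ?_
    rw [Finset.sum_mul]
    refine Finset.sum_congr rfl fun π _ => ?_
    rw [← Equiv.prod_comp σ (fun a => x (pairEquiv n a) ^ (pairEquiv n (π a) : ℕ)),
      ← Equiv.prod_comp (σ.trans (pairEquiv n)) (fun i => lineWeight V t (x i)),
      Fintype.prod_sum_type, Fintype.prod_sum_type]
    simp only [g, Finset.prod_mul_distrib, signMatrix, of_apply, Function.comp_apply,
      Equiv.trans_apply, Perm.mul_apply, Perm.sign_mul, Units.val_mul, Int.cast_mul]
    ring
  simp_rw [hexp]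
  have hint := fun σ π : Perm (Fin n ⊕ Fin n) =>
    (key σ π).1.const_mul (((Perm.sign (π * σ) : ℤ) : ℝ))
  rw [integral_finsetSum _ fun σ _ => integrable_finsetSum _ fun π _ => hint σ π]
  have hσ : ∀ σ : Perm (Fin n ⊕ Fin n), ∫ x : Fin (2 * n) → ℝ, (∑ π : Perm (Fin n ⊕ Fin n),
        ((Perm.sign (π * σ) : ℤ) : ℝ) * ∏ k, g (π * σ) k
          (x ((σ.trans (pairEquiv n)) (Sum.inl k)), x ((σ.trans (pairEquiv n)) (Sum.inr k))))
        ∂(Measure.pi fun _ => volume.restrict E) =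
      pfSum (Matrix.of fun a b => moment V E t (-t) (pairEquiv n a) (pairEquiv n b)) := by
    intro σ
    rw [integral_finsetSum _ fun π _ => hint σ π]
    simp_rw [integral_const_mul]
    rw [pfSum]
    -- For fixed `σ` the product `π * σ` runs over all permutations, so each of the `(2n)!` values
    -- of `σ` contributes the same `pfSum`.
    refine Fintype.sum_equiv (Equiv.mulRight σ) _ _ fun π => ?_
    rw [(key σ π).2, Equiv.coe_mulRight]
    congr 1
    exact Finset.prod_congr rfl fun k _ => (integrable_skew ht (Fin.is_lt _) (Fin.is_lt _)).2
  rw [Finset.sum_congr rfl fun σ _ => hσ σ]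
  simp [Fintype.card_perm, two_mul]

/-- The Pfaffian tau function as an integral over `E^{2n}`. -/
theorem exists_pfaffianTau_eq (n : ℕ) : ∃ c : ℝ, 0 < c ∧ ∀ (V : ℝ → ℝ) (E : Set ℝ) (t : ℕ+ → ℝ),
    Converges V E (2 * n) t → pfaffianTau V E (2 * n) t =
      c * ∫ x : Fin (2 * n) → ℝ, |(vandermonde x).det| * ∏ i, lineWeight V t (x i)
        ∂(Measure.pi fun _ => volume.restrict E) := by
  obtain ⟨K, hK, hKA⟩ := exists_pfSum_sq n
  obtain ⟨κ, hκ, hκx⟩ := exists_pfSum_signMatrix n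
  have hfac : (0 : ℝ) < ((2 * n).factorial : ℝ) := by positivity
  -- Obtained from `κ I = (2n)! pfSum A` and `pfSum A ^ 2 = K det A`. The sign of `κ` is not
  -- determined, but only its square enters the determinant.
  refine ⟨|κ| / (((2 * n).factorial : ℝ) * Real.sqrt K), by positivity, fun V E t ht => ?_⟩
  set I := ∫ x : Fin (2 * n) → ℝ, |(vandermonde x).det| * ∏ i, lineWeight V t (x i)
        ∂(Measure.pi fun _ => volume.restrict E) with hI
  have hI0 : 0 ≤ I := integral_nonneg fun x =>
    mul_nonneg (abs_nonneg _) (Finset.prod_nonneg fun i _ => (Real.exp_pos _).le)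
  let A : Matrix (Fin n ⊕ Fin n) (Fin n ⊕ Fin n) ℝ :=
    Matrix.of fun a b => moment V E t (-t) (pairEquiv n a) (pairEquiv n b)
  have h1 : κ * I = ((2 * n).factorial : ℝ) * pfSum A := by
    rw [← pfSum_moments ht, hI, ← integral_const_mul]
    refine integral_congr_ae (Filter.Eventually.of_forall fun x => ?_)
    simp only [hκx, mul_assoc]
  have hA : Aᵀ = -A := by
    ext a b
    exact moment_skew ht (Fin.is_lt _) (Fin.is_lt _)
  have hτ : tau V E (2 * n) t (-t) = A.det := by
    rw [tau, ← det_submatrix_equiv_self (pairEquiv n)]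
    rfl
  have h2 : tau V E (2 * n) t (-t) =
      (|κ| / (((2 * n).factorial : ℝ) * Real.sqrt K) * I) ^ 2 := by
    have h3 := hKA A hA
    have h4 : pfSum A = κ * I / ((2 * n).factorial : ℝ) := by
      rw [h1]; field_simp
    rw [hτ, mul_pow, div_pow, mul_pow, Real.sq_sqrt hK.le, sq_abs]
    have h5 : A.det = pfSum A ^ 2 / K := by rw [h3]; field_simp
    rw [h5, h4]
    field_simp
  rw [pfaffianTau, h2, Real.sqrt_sq (by positivity)]

end DeBruijn

end PfaffianTau

namespace PfaffianTau

open Matrix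

/-! ### Linear coordinates on symmetric and skew-symmetric matrices -/

section SymmetricCoordinates

/-- The positions strictly above the diagonal. -/
abbrev UpperPairs (N : ℕ) : Type := {p : Fin N × Fin N // p.1 < p.2}

/-- Coordinates of symmetric matrices: diagonal and strictly upper triangular entries. -/
abbrev SymCoord (N : ℕ) : Type := (Fin N → ℝ) × (UpperPairs N → ℝ)

variable {N : ℕ}

/-- The skew-symmetric matrix with given entries above the diagonal. -/
def skewOf : (UpperPairs N → ℝ) →ₗ[ℝ] Matrix (Fin N) (Fin N) ℝ where
  toFun k := Matrix.of fun i j =>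
    if h : i < j then k ⟨(i, j), h⟩ else if h : j < i then -k ⟨(j, i), h⟩ else 0
  map_add' k k' := by
    ext i j; simp only [of_apply, Matrix.add_apply]; split_ifs <;> simp; ring
  map_smul' a k := by
    ext i j; simp only [of_apply, Matrix.smul_apply]; split_ifs <;> simp

/-- The symmetric matrix with given coordinates. -/
def symOf : SymCoord N →ₗ[ℝ] Matrix (Fin N) (Fin N) ℝ where
  toFun p := Matrix.of fun i j =>
    if h : i < j then p.2 ⟨(i, j), h⟩ else if h : j < i then p.2 ⟨(j, i), h⟩ else p.1 i
  map_add' k k' := by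
    ext i j; simp only [of_apply, Matrix.add_apply]; split_ifs <;> simp
  map_smul' a k := by
    ext i j; simp only [of_apply, Matrix.smul_apply]; split_ifs <;> simp

/-- The entries of a matrix on and above the diagonal. -/
def coordOf : Matrix (Fin N) (Fin N) ℝ →ₗ[ℝ] SymCoord N where
  toFun X := (fun i => X i i, fun p => X p.1.1 p.1.2)
  map_add' _ _ := rfl
  map_smul' _ _ := rfl

theorem coordOf_fst (X : Matrix (Fin N) (Fin N) ℝ) (i : Fin N) : (coordOf X).1 i = X i i := rfl

theorem coordOf_snd (X : Matrix (Fin N) (Fin N) ℝ) (q : UpperPairs N) :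
    (coordOf X).2 q = X q.1.1 q.1.2 := rfl

theorem symOf_transpose (p : SymCoord N) : (symOf p)ᵀ = symOf p := by
  ext i j
  rcases lt_trichotomy i j with h | h | h
  · simp [symOf, h, h.not_gt]
  · subst h; rfl
  · simp [symOf, h, h.not_gt]

theorem skewOf_transpose (k : UpperPairs N → ℝ) : (skewOf k)ᵀ = -skewOf k := by
  ext i j
  rcases lt_trichotomy i j with h | h | h
  · simp [skewOf, h, h.not_gt]
  · subst h; simp [skewOf]
  · simp [skewOf, h, h.not_gt]

theorem coordOf_symOf (p : SymCoord N) : coordOf (symOf p) = p := by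
  refine Prod.ext (funext fun i => by simp [coordOf_fst, symOf]) (funext fun q => ?_)
  have := q.2
  simp [coordOf_snd, symOf, this]

theorem symOf_coordOf {X : Matrix (Fin N) (Fin N) ℝ} (hX : Xᵀ = X) : symOf (coordOf X) = X := by
  ext i j
  have hs : X j i = X i j := congrFun (congrFun hX i) j
  rcases lt_trichotomy i j with h | h | h
  · simp [coordOf_snd, symOf, h]
  · subst h; simp [coordOf_fst, symOf]
  · simp [coordOf_snd, symOf, h, h.not_gt, hs]

theorem symOf_diag (d : Fin N → ℝ) : symOf (d, 0) = diagonal d := by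
  ext i j
  rcases lt_trichotomy i j with h | h | h
  · simp [symOf, h, h.ne]
  · subst h; simp [symOf]
  · simp [symOf, h, h.not_gt, h.ne']

theorem skewOf_coordOf {X : Matrix (Fin N) (Fin N) ℝ} (hX : Xᵀ = -X) :
    skewOf (coordOf X).2 = X := by
  ext i j
  have hs : X j i = -X i j := congrFun (congrFun hX i) j
  rcases lt_trichotomy i j with h | h | h
  · simp [coordOf_snd, skewOf, h]
  · subst h; simp [skewOf]; linarith
  · simp [coordOf_snd, skewOf, h, h.not_gt, hs]

theorem coordOf_skewOf (k : UpperPairs N → ℝ) : (coordOf (skewOf k)).2 = k := by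
  funext q
  have := q.2
  simp [coordOf_snd, skewOf, this]

theorem skewOf_injective : Function.Injective (skewOf (N := N)) := fun k k' h => by
  rw [← coordOf_skewOf k, h, coordOf_skewOf]

/-- Conjugation `X ↦ U X Uᵀ` in coordinates. -/
def conjMap (U : Matrix (Fin N) (Fin N) ℝ) : SymCoord N →ₗ[ℝ] SymCoord N where
  toFun p := coordOf (U * symOf p * Uᵀ)
  map_add' p q := by rw [map_add, mul_add, add_mul, map_add]
  map_smul' a p := by
    rw [map_smul, Matrix.mul_smul, Matrix.smul_mul, map_smul, RingHom.id_apply]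

theorem symOf_conjMap (U : Matrix (Fin N) (Fin N) ℝ) (p : SymCoord N) :
    symOf (conjMap U p) = U * symOf p * Uᵀ :=
  symOf_coordOf (by simp [transpose_mul, symOf_transpose, mul_assoc])

theorem conjMap_mul (U U' : Matrix (Fin N) (Fin N) ℝ) (p : SymCoord N) :
    conjMap (U * U') p = conjMap U (conjMap U' p) := by
  change coordOf _ = coordOf _
  rw [symOf_conjMap, transpose_mul]
  simp only [mul_assoc]

theorem conjMap_one (p : SymCoord N) : conjMap 1 p = p := by
  change coordOf _ = p
  simp [coordOf_symOf]

end SymmetricCoordinates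

/-! ### The Cayley chart and its derivative -/

section Cayley

variable {N : ℕ}

/-- If `K v = v`, then `v ⬝ᵥ v = v ⬝ᵥ K v`, which vanishes by skew-symmetry. -/
theorem isUnit_one_sub_skew {K : Matrix (Fin N) (Fin N) ℝ} (hK : Kᵀ = -K) : IsUnit (1 - K) := by
  rw [isUnit_iff_isUnit_det, isUnit_iff_ne_zero]
  intro h0
  obtain ⟨v, hv0, hv⟩ := exists_mulVec_eq_zero_iff.2 h0
  have h1 : K *ᵥ v = v := by
    rw [sub_mulVec, one_mulVec, sub_eq_zero] at hv
    exact hv.symm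
  have h2 : v ⬝ᵥ K *ᵥ v = -(v ⬝ᵥ K *ᵥ v) := by
    conv_lhs => rw [dotProduct_mulVec, ← mulVec_transpose, hK, neg_mulVec, neg_dotProduct,
      dotProduct_comm]
  rw [h1] at h2
  exact hv0 (dotProduct_self_eq_zero.1 (by linarith))

/-- The resolvent `(1 - K)⁻¹` of a skew-symmetric matrix. -/
noncomputable def resolvent (k : UpperPairs N → ℝ) : Matrix (Fin N) (Fin N) ℝ := (1 - skewOf k)⁻¹

/-- The Cayley transform `(1 + K) (1 - K)⁻¹ = 2 (1 - K)⁻¹ - 1` of a skew-symmetric matrix. -/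
noncomputable def cayley (k : UpperPairs N → ℝ) : Matrix (Fin N) (Fin N) ℝ :=
  (2 : ℝ) • resolvent k - 1

theorem isUnit_det_one_sub_skewOf (k : UpperPairs N → ℝ) : IsUnit (1 - skewOf k).det :=
  (isUnit_iff_isUnit_det _).1 (isUnit_one_sub_skew (skewOf_transpose k))

theorem resolvent_mul (k : UpperPairs N → ℝ) : resolvent k * (1 - skewOf k) = 1 :=
  nonsing_inv_mul _ (isUnit_det_one_sub_skewOf k)

theorem mul_resolvent (k : UpperPairs N → ℝ) : (1 - skewOf k) * resolvent k = 1 :=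
  mul_nonsing_inv _ (isUnit_det_one_sub_skewOf k)

theorem resolvent_transpose_mul (k : UpperPairs N → ℝ) :
    (resolvent k)ᵀ * (1 + skewOf k) = 1 := by
  have := congrArg transpose (mul_resolvent k)
  simpa [transpose_mul, skewOf_transpose] using this

theorem cayley_transpose (k : UpperPairs N → ℝ) :
    (cayley k)ᵀ = (resolvent k)ᵀ * (1 - skewOf k) := by
  have h : (2 : ℝ) • (resolvent k)ᵀ - (resolvent k)ᵀ * (1 + skewOf k) =
      (resolvent k)ᵀ * (1 - skewOf k) := by
    rw [two_smul]; noncomm_ring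
  rw [← h, resolvent_transpose_mul]
  simp [cayley]

theorem cayley_eq (k : UpperPairs N → ℝ) : cayley k = (1 + skewOf k) * resolvent k := by
  have h : (2 : ℝ) • (resolvent k) - (1 - skewOf k) * (resolvent k) =
      (1 + skewOf k) * resolvent k := by
    rw [two_smul]; noncomm_ring
  rw [← h, mul_resolvent]; rfl

theorem cayley_transpose_mul_cayley (k : UpperPairs N → ℝ) : (cayley k)ᵀ * cayley k = 1 := by
  have hcomm : (1 - skewOf k) * (1 + skewOf k) = (1 + skewOf k) * (1 - skewOf k) := by noncomm_ring
  rw [cayley_transpose, cayley_eq]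
  calc (resolvent k)ᵀ * (1 - skewOf k) * ((1 + skewOf k) * resolvent k)
      = (resolvent k)ᵀ * ((1 - skewOf k) * (1 + skewOf k)) * resolvent k := by noncomm_ring
    _ = ((resolvent k)ᵀ * (1 + skewOf k)) * ((1 - skewOf k) * resolvent k) := by
        rw [hcomm]; noncomm_ring
    _ = 1 := by rw [resolvent_transpose_mul, mul_resolvent, one_mul]

theorem cayley_mul_cayley_transpose (k : UpperPairs N → ℝ) : cayley k * (cayley k)ᵀ = 1 :=
  mul_eq_one_comm.1 (cayley_transpose_mul_cayley k)

theorem cayley_injective : Function.Injective (cayley (N := N)) := by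
  intro k k' h
  have h1 : resolvent k = resolvent k' := by
    have : (2 : ℝ) • resolvent k = (2 : ℝ) • resolvent k' := sub_left_injective h
    exact smul_right_injective _ (two_ne_zero) this
  have h2 : 1 - skewOf k = 1 - skewOf k' := by
    calc 1 - skewOf k = (1 - skewOf k) * (resolvent k' * (1 - skewOf k')) := by
          rw [resolvent_mul, mul_one]
      _ = 1 - skewOf k' := by rw [← h1, ← mul_assoc, mul_resolvent, one_mul]
  exact skewOf_injective (sub_right_injective h2)

theorem cayley_zero : cayley (0 : UpperPairs N → ℝ) = 1 := by
  simp only [cayley, resolvent, map_zero, sub_zero, inv_one, two_smul]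
  abel

theorem continuous_skewOf : Continuous (skewOf (N := N)) :=
  skewOf.continuous_of_finiteDimensional

theorem continuous_resolvent : Continuous (resolvent (N := N)) := by
  have h : ∀ k : UpperPairs N → ℝ, resolvent k =
      ((1 - skewOf k).det)⁻¹ • (1 - skewOf k).adjugate := fun k => by
    rw [resolvent, inv_def, Ring.inverse_eq_inv']
  have hc : Continuous fun k : UpperPairs N → ℝ => 1 - skewOf k :=
    continuous_const.sub continuous_skewOf
  rw [show resolvent (N := N) = fun k => ((1 - skewOf k).det)⁻¹ • (1 - skewOf k).adjugate
    from funext h]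
  exact (hc.matrix_det.inv₀ fun k => (isUnit_det_one_sub_skewOf k).ne_zero).smul hc.matrix_adjugate

theorem continuous_cayley : Continuous (cayley (N := N)) :=
  (continuous_resolvent.const_smul (2 : ℝ)).sub continuous_const

/-- The logarithmic derivative of the Cayley transform. -/
noncomputable def cayleyForm (k : UpperPairs N → ℝ) : (UpperPairs N → ℝ) →ₗ[ℝ] (UpperPairs N → ℝ) where
  toFun k' := (coordOf ((2 : ℝ) • ((resolvent k)ᵀ * skewOf k' * resolvent k))).2
  map_add' a b := by
    rw [map_add, mul_add, add_mul, smul_add, map_add]; rfl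
  map_smul' a b := by
    rw [map_smul skewOf, Matrix.mul_smul, Matrix.smul_mul, smul_comm, map_smul coordOf]; rfl

theorem skewOf_cayleyForm (k k' : UpperPairs N → ℝ) :
    skewOf (cayleyForm k k') = (2 : ℝ) • ((resolvent k)ᵀ * skewOf k' * resolvent k) := by
  have h : ((2 : ℝ) • ((resolvent k)ᵀ * skewOf k' * resolvent k))ᵀ =
      -((2 : ℝ) • ((resolvent k)ᵀ * skewOf k' * resolvent k)) := by
    simp [transpose_mul, skewOf_transpose, mul_assoc]
  exact skewOf_coordOf h

/-- The Jacobian of the Cayley transform. -/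
noncomputable def cayleyJac (k : UpperPairs N → ℝ) : ℝ := |LinearMap.det (cayleyForm k)|

theorem continuous_cayleyJac : Continuous (cayleyJac (N := N)) := by
  have h : ∀ k : UpperPairs N → ℝ, cayleyJac k = |(LinearMap.toMatrix' (cayleyForm k)).det| :=
    fun k => by rw [LinearMap.det_toMatrix', cayleyJac]
  rw [show cayleyJac (N := N) = fun k => |(LinearMap.toMatrix' (cayleyForm k)).det| from funext h]
  refine (Continuous.matrix_det ?_).abs
  refine continuous_matrix fun p q => ?_
  simp only [LinearMap.toMatrix'_apply]
  have : Continuous fun k : UpperPairs N → ℝ =>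
      (2 : ℝ) • ((resolvent k)ᵀ * skewOf (Pi.single q 1) * resolvent k) :=
    (((continuous_resolvent.matrix_transpose).matrix_mul continuous_const).matrix_mul
      continuous_resolvent).const_smul (2 : ℝ)
  exact this.matrix_elem p.1.1 p.1.2

theorem cayleyJac_zero_pos : 0 < cayleyJac (0 : UpperPairs N → ℝ) := by
  have : cayleyForm (0 : UpperPairs N → ℝ) = (2 : ℝ) • LinearMap.id := by
    refine LinearMap.ext fun x => ?_
    apply skewOf_injective
    rw [skewOf_cayleyForm]
    simp [resolvent]
  rw [cayleyJac, this]
  simp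

/-- Multiplication of the entries above the diagonal by differences of eigenvalues. -/
def gapMap (d : Fin N → ℝ) : (UpperPairs N → ℝ) →ₗ[ℝ] (UpperPairs N → ℝ) where
  toFun k p := (d p.1.2 - d p.1.1) * k p
  map_add' a b := by funext p; simp [mul_add]
  map_smul' a b := by funext p; simp; ring

theorem det_gapMap (d : Fin N → ℝ) : LinearMap.det (gapMap d) = (vandermonde d).det := by
  have h : LinearMap.toMatrix' (gapMap d) =
      diagonal fun p : UpperPairs N => d p.1.2 - d p.1.1 := by
    ext p q
    rw [LinearMap.toMatrix'_apply]
    by_cases hpq : p = q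
    · subst hpq; simp [gapMap]
    · simp [gapMap, hpq]
  rw [← LinearMap.det_toMatrix', h, det_diagonal, det_vandermonde]
  rw [Finset.prod_sigma']
  refine Finset.prod_bij' (fun p _ => ⟨p.1.1, p.1.2⟩)
    (fun q hq => ⟨(q.1, q.2), by simpa using hq⟩) ?_ ?_ ?_ ?_ ?_ <;> simp

/-- The parametrization of symmetric matrices by eigenvalues and Cayley coordinates. -/
noncomputable def eigenChart (p : SymCoord N) : SymCoord N := conjMap (cayley p.2) (p.1, 0)

theorem symOf_eigenChart (p : SymCoord N) :
    symOf (eigenChart p) = cayley p.2 * diagonal p.1 * (cayley p.2)ᵀ := by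
  rw [eigenChart, symOf_conjMap, symOf_diag]

/-- The derivative of the parametrization. -/
noncomputable def eigenChartDeriv (p : SymCoord N) : SymCoord N →ₗ[ℝ] SymCoord N :=
  conjMap (cayley p.2) ∘ₗ (LinearMap.id.prodMap (gapMap p.1)) ∘ₗ
    (LinearMap.id.prodMap (cayleyForm p.2))

/-- The commutator of a skew matrix with `diagonal d` has entries `(d_j - d_i) k_ij`. This is how
the Vandermonde determinant enters the Jacobian. -/
theorem symOf_gap (d d' : Fin N → ℝ) (k' : UpperPairs N → ℝ) :
    symOf (d', gapMap d k') = diagonal d' + skewOf k' * diagonal d - diagonal d * skewOf k' := by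
  ext i j
  simp only [Matrix.sub_apply, Matrix.add_apply, mul_diagonal, diagonal_mul]
  rcases lt_trichotomy i j with h | h | h
  · simp [symOf, skewOf, gapMap, h, h.ne]; ring
  · subst h; simp [symOf, skewOf]
  · simp [symOf, skewOf, gapMap, h, h.not_gt, h.ne']; ring

section Derivative

attribute [local instance] Matrix.linftyOpNormedRing Matrix.linftyOpNormedAlgebra

theorem hasFDerivAt_resolvent (k : UpperPairs N → ℝ) :
    ∃ F : (UpperPairs N → ℝ) →L[ℝ] Matrix (Fin N) (Fin N) ℝ, HasFDerivAt resolvent F k ∧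
      ∀ k', F k' = resolvent k * skewOf k' * resolvent k := by
  have hu := isUnit_one_sub_skew (skewOf_transpose k)
  have h1 := hasFDerivAt_ringInverse (𝕜 := ℝ) hu.unit
  have h2 : HasFDerivAt (fun k : UpperPairs N → ℝ => 1 - skewOf k)
      (-(LinearMap.toContinuousLinearMap skewOf)) k :=
    (LinearMap.toContinuousLinearMap skewOf).hasFDerivAt.const_sub 1
  have h3 : resolvent (N := N) = Ring.inverse ∘ fun k => 1 - skewOf k := by
    funext k; exact nonsing_inv_eq_ringInverse _
  have h4 : ((hu.unit⁻¹ : (Matrix (Fin N) (Fin N) ℝ)ˣ) : Matrix (Fin N) (Fin N) ℝ) = resolvent k := by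
    rw [h3, ← Ring.inverse_unit]; rfl
  refine ⟨_, by rw [h3]; exact HasFDerivAt.comp k h1 h2, fun k' => ?_⟩
  rw [h4]
  change -(resolvent k * (-(skewOf k')) * resolvent k) = _
  rw [mul_neg, neg_mul, neg_neg]

theorem hasFDerivAt_eigenChart (p : SymCoord N) :
    HasFDerivAt eigenChart (LinearMap.toContinuousLinearMap (eigenChartDeriv p)) p := by
  obtain ⟨F, hF, hFk⟩ := hasFDerivAt_resolvent p.2
  have hR : HasFDerivAt (fun q : SymCoord N => resolvent q.2)
      (F.comp (ContinuousLinearMap.snd ℝ _ _)) p := hF.comp p hasFDerivAt_snd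
  have hU : HasFDerivAt (fun q : SymCoord N => cayley q.2)
      ((2 : ℝ) • (F.comp (ContinuousLinearMap.snd ℝ _ _))) p := (hR.const_smul (2 : ℝ)).sub_const 1
  let dg : (Fin N → ℝ) →ₗ[ℝ] Matrix (Fin N) (Fin N) ℝ := diagonalLinearMap (Fin N) ℝ ℝ
  have hD : HasFDerivAt (fun q : SymCoord N => diagonal q.1)
      ((LinearMap.toContinuousLinearMap dg).comp (ContinuousLinearMap.fst ℝ _ _)) p :=
    (LinearMap.toContinuousLinearMap dg).hasFDerivAt.comp p hasFDerivAt_fst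
  let tr : Matrix (Fin N) (Fin N) ℝ →ₗ[ℝ] Matrix (Fin N) (Fin N) ℝ :=
    (transposeLinearEquiv (Fin N) (Fin N) ℝ ℝ).toLinearMap
  have hUt : HasFDerivAt (fun q : SymCoord N => (cayley q.2)ᵀ)
      ((LinearMap.toContinuousLinearMap tr).comp
        ((2 : ℝ) • (F.comp (ContinuousLinearMap.snd ℝ _ _)))) p :=
    (LinearMap.toContinuousLinearMap tr).hasFDerivAt.comp p hU
  have hM := (hU.mul' hD).mul' hUt
  have hC := (LinearMap.toContinuousLinearMap (coordOf (N := N))).hasFDerivAt.comp p hM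
  have he : eigenChart (N := N) = (LinearMap.toContinuousLinearMap (coordOf (N := N))) ∘
      fun q => cayley q.2 * diagonal q.1 * (cayley q.2)ᵀ := by
    funext q
    change _ = coordOf (cayley q.2 * diagonal q.1 * (cayley q.2)ᵀ)
    rw [← symOf_eigenChart, coordOf_symOf]
  rw [he]
  refine hC.congr_fderiv ?_
  refine ContinuousLinearMap.ext fun q => ?_
  -- The derivative of the Cayley transform `U` is put in the form `U W` with `W` skew. The
  -- derivative of `U D Uᵀ` then becomes `U (D' + W D - D W) Uᵀ`.
  have hW : (2 : ℝ) • (resolvent p.2 * skewOf q.2 * resolvent p.2) =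
      cayley p.2 * skewOf (cayleyForm p.2 q.2) := by
    have h1 : (resolvent p.2)ᵀ = (cayley p.2)ᵀ * resolvent p.2 := by
      rw [cayley_transpose, mul_assoc, mul_resolvent, mul_one]
    rw [skewOf_cayleyForm, h1, Matrix.mul_smul]
    simp only [← mul_assoc, cayley_mul_cayley_transpose, one_mul]
  have hWt : ((2 : ℝ) • (resolvent p.2 * skewOf q.2 * resolvent p.2))ᵀ =
      -(skewOf (cayleyForm p.2 q.2) * (cayley p.2)ᵀ) := by
    rw [hW, transpose_mul, skewOf_transpose, neg_mul]
  have hgoal : eigenChartDeriv p q = coordOf (cayley p.2 * (diagonal q.1 +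
      skewOf (cayleyForm p.2 q.2) * diagonal p.1 - diagonal p.1 * skewOf (cayleyForm p.2 q.2)) *
      (cayley p.2)ᵀ) := by
    rw [← symOf_gap]; rfl
  rw [LinearMap.coe_toContinuousLinearMap', hgoal]
  change coordOf ((cayley p.2 * diagonal p.1) * ((2 : ℝ) • F q.2)ᵀ +
    (cayley p.2 * diagonal q.1 + ((2 : ℝ) • F q.2) * diagonal p.1) * (cayley p.2)ᵀ) = _
  rw [hFk, hWt, hW]
  congr 1
  noncomm_ring

end Derivative

end Cayley

/-! ### Orthogonal invariance of Lebesgue measure -/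

section Invariance

variable {N : ℕ}

instance instIsAddHaarMeasureSymCoord : (volume : Measure (SymCoord N)).IsAddHaarMeasure :=
  Measure.prod.instIsAddHaarMeasure _ _

theorem continuous_symOf : Continuous (symOf (N := N)) := symOf.continuous_of_finiteDimensional

theorem continuous_coordOf : Continuous (coordOf (N := N)) :=
  coordOf.continuous_of_finiteDimensional

/-- The function `Tr X²` in coordinates. -/
noncomputable def sqNorm (p : SymCoord N) : ℝ := (symOf p * symOf p).trace

theorem continuous_sqNorm : Continuous (sqNorm (N := N)) :=
  (continuous_symOf.matrix_mul continuous_symOf).matrix_trace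

theorem sqNorm_eq (p : SymCoord N) : sqNorm p = ∑ i, ∑ j, symOf p i j ^ 2 := by
  simp only [sqNorm, trace, diag_apply, mul_apply]
  refine Finset.sum_congr rfl fun i _ => Finset.sum_congr rfl fun j _ => ?_
  rw [sq, ← congrFun (congrFun (symOf_transpose p) i) j, transpose_apply]

theorem trace_conj {U : Matrix (Fin N) (Fin N) ℝ} (hU : Uᵀ * U = 1) (X : Matrix (Fin N) (Fin N) ℝ) :
    (U * X * Uᵀ).trace = X.trace := by
  rw [trace_mul_comm, ← mul_assoc, hU, one_mul]

theorem conj_pow {U : Matrix (Fin N) (Fin N) ℝ} (hU : Uᵀ * U = 1) (X : Matrix (Fin N) (Fin N) ℝ)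
    (m : ℕ) : (U * X * Uᵀ) ^ m = U * X ^ m * Uᵀ := by
  induction m with
  | zero => simp [mul_eq_one_comm.1 hU]
  | succ m ih =>
    rw [pow_succ, ih, pow_succ]
    calc U * X ^ m * Uᵀ * (U * X * Uᵀ) = U * X ^ m * (Uᵀ * U) * X * Uᵀ := by noncomm_ring
      _ = U * (X ^ m * X) * Uᵀ := by rw [hU]; noncomm_ring

theorem sqNorm_conjMap {U : Matrix (Fin N) (Fin N) ℝ} (hU : Uᵀ * U = 1) (p : SymCoord N) :
    sqNorm (conjMap U p) = sqNorm p := by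
  rw [sqNorm, ← sq, symOf_conjMap, conj_pow hU, trace_conj hU, sq]; rfl

theorem volume_sqNorm_le : volume {p : SymCoord N | sqNorm p ≤ 1} ≠ 0 ∧
    volume {p : SymCoord N | sqNorm p ≤ 1} ≠ ⊤ := by
  constructor
  · have h1 : IsOpen {p : SymCoord N | sqNorm p < 1} := isOpen_lt continuous_sqNorm continuous_const
    have h2 : ({p : SymCoord N | sqNorm p < 1}).Nonempty := ⟨0, by simp [sqNorm]⟩
    exact ((h1.measure_pos volume h2).trans_le
      (measure_mono fun p (hp : sqNorm p < 1) => hp.le)).ne'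
  · have h1 : {p : SymCoord N | sqNorm p ≤ 1} ⊆ Metric.closedBall 0 1 := by
      intro p (hp : sqNorm p ≤ 1)
      have hent : ∀ i j, ‖symOf p i j‖ ≤ 1 := by
        intro i j
        rw [sqNorm_eq] at hp
        have h2 : symOf p i j ^ 2 ≤ ∑ i, ∑ j, symOf p i j ^ 2 :=
          (Finset.single_le_sum (f := fun j => symOf p i j ^ 2) (fun j _ => sq_nonneg _)
            (Finset.mem_univ j)).trans
          (Finset.single_le_sum (f := fun i => ∑ j, symOf p i j ^ 2)
            (fun i _ => Finset.sum_nonneg fun j _ => sq_nonneg _) (Finset.mem_univ i))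
        rw [Real.norm_eq_abs]
        exact (sq_le_one_iff_abs_le_one _).1 (h2.trans hp)
      rw [mem_closedBall_zero_iff, ← coordOf_symOf p, Prod.norm_def]
      refine max_le ((pi_norm_le_iff_of_nonneg zero_le_one).2 fun i => hent i i)
        ((pi_norm_le_iff_of_nonneg zero_le_one).2 fun q => hent _ _)
    exact ((measure_mono h1).trans_lt measure_closedBall_lt_top).ne

/-- Conjugation preserves the ball `Tr X² ≤ 1`, which has positive finite volume, so its volume
scaling factor is `1`. -/
theorem abs_det_conjMap {U : Matrix (Fin N) (Fin N) ℝ} (hU : Uᵀ * U = 1) :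
    |LinearMap.det (conjMap U)| = 1 := by
  have hU' : U * Uᵀ = 1 := mul_eq_one_comm.1 hU
  have hinv : conjMap Uᵀ ∘ₗ conjMap U = LinearMap.id := by
    refine LinearMap.ext fun p => ?_
    rw [LinearMap.comp_apply, ← conjMap_mul, hU, conjMap_one]; rfl
  have hdet : LinearMap.det (conjMap U) ≠ 0 := by
    intro h0
    have := congrArg LinearMap.det hinv
    rw [LinearMap.det_comp, h0] at this
    simp at this
  have h := Measure.addHaar_preimage_linearMap (volume : Measure (SymCoord N)) hdet
    {p | sqNorm p ≤ 1}
  have h2 : (conjMap U) ⁻¹' {p | sqNorm p ≤ 1} = {p | sqNorm p ≤ 1} := by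
    ext p; simp only [Set.mem_preimage, Set.mem_ofPred_eq, sqNorm_conjMap hU]
  rw [h2] at h
  have h3 : ENNReal.ofReal |(LinearMap.det (conjMap U))⁻¹| = 1 := by
    have := (ENNReal.mul_eq_right volume_sqNorm_le.1 volume_sqNorm_le.2).1 h.symm
    exact this
  rw [ENNReal.ofReal_eq_one, abs_inv, inv_eq_one] at h3
  exact h3

theorem measurePreserving_conjMap {U : Matrix (Fin N) (Fin N) ℝ} (hU : Uᵀ * U = 1) :
    MeasurePreserving (conjMap U) volume volume := by
  have hc : Continuous (conjMap U) := (conjMap U).continuous_of_finiteDimensional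
  refine ⟨hc.measurable, ?_⟩
  have h1 := abs_det_conjMap hU
  rw [Measure.map_linearMap_addHaar_eq_smul_addHaar _ (fun h0 => by simp [h0] at h1), abs_inv, h1]
  simp

end Invariance

/-! ### Spectral theorem, simple spectrum, averaging over the orthogonal group -/

section Orthogonal

variable {N : ℕ}

/-- Compactness makes the Haar measure finite, which the averaging argument needs. -/
instance instCompactSpaceOrthogonalGroup : CompactSpace (orthogonalGroup (Fin N) ℝ) := by
  suffices h : IsCompact (orthogonalGroup (Fin N) ℝ : Set (Matrix (Fin N) (Fin N) ℝ)) from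
    isCompact_iff_compactSpace.1 h
  have hK : IsCompact (Set.univ.pi fun _ : Fin N => Set.univ.pi fun _ : Fin N =>
      Set.Icc (-1 : ℝ) 1) := isCompact_univ_pi fun _ => isCompact_univ_pi fun _ => isCompact_Icc
  refine hK.of_isClosed_subset ?_ ?_
  · have : (orthogonalGroup (Fin N) ℝ : Set (Matrix (Fin N) (Fin N) ℝ)) = {A | A * Aᵀ = 1} := by
      ext A; exact mem_orthogonalGroup_iff _ _
    rw [this]
    exact isClosed_eq (continuous_id.matrix_mul continuous_id.matrix_transpose) continuous_const
  · intro (A : Matrix (Fin N) (Fin N) ℝ) hA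
    have h1 : A * Aᵀ = 1 := (mem_orthogonalGroup_iff _ _).1 hA
    suffices h : ∀ i j, A i j ∈ Set.Icc (-1 : ℝ) 1 from fun i _ j _ => h i j
    intro i j
    have h2 : ∑ k, A i k ^ 2 = 1 := by
      have := congrFun (congrFun h1 i) i
      simpa [mul_apply, sq] using this
    have h3 : A i j ^ 2 ≤ 1 := by
      rw [← h2]
      exact Finset.single_le_sum (f := fun k => A i k ^ 2) (fun k _ => sq_nonneg _)
        (Finset.mem_univ j)
    exact abs_le.1 ((sq_le_one_iff_abs_le_one _).1 h3)

instance instSecondCountableMatrix : SecondCountableTopology (Matrix (Fin N) (Fin N) ℝ) :=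
  inferInstanceAs (SecondCountableTopology (Fin N → Fin N → ℝ))

theorem orthogonal_transpose_mul (U : orthogonalGroup (Fin N) ℝ) :
    (U : Matrix (Fin N) (Fin N) ℝ)ᵀ * U = 1 := (mem_orthogonalGroup_iff' _ _).1 U.2

theorem orthogonal_mul_transpose (U : orthogonalGroup (Fin N) ℝ) :
    (U : Matrix (Fin N) (Fin N) ℝ) * (U : Matrix (Fin N) (Fin N) ℝ)ᵀ = 1 :=
  (mem_orthogonalGroup_iff _ _).1 U.2

/-- The spectral theorem in coordinates. -/
theorem exists_eq_conjMap_eigenvalues {p : SymCoord N} (hH : (symOf p).IsHermitian) :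
    ∃ U : orthogonalGroup (Fin N) ℝ, p = conjMap U (hH.eigenvalues, 0) := by
  refine ⟨hH.eigenvectorUnitary, ?_⟩
  have h1 := hH.spectral_theorem
  rw [Unitary.conjStarAlgAut_apply] at h1
  refine (coordOf_symOf p).symm.trans ((congrArg coordOf h1).trans ?_)
  change _ = coordOf _
  rw [symOf_diag]
  rfl

theorem isHermitian_symOf (p : SymCoord N) : (symOf p).IsHermitian := by
  rw [IsHermitian, conjTranspose_eq_transpose_of_trivial]; exact symOf_transpose p

/-- The determinant of the matrix `(Tr X^{i+j})`, which is the discriminant of `X`. -/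
noncomputable def hankelDet (X : Matrix (Fin N) (Fin N) ℝ) : ℝ :=
  (Matrix.of fun i j : Fin N => (X ^ ((i : ℕ) + (j : ℕ))).trace).det

theorem hankelDet_conj {U : Matrix (Fin N) (Fin N) ℝ} (hU : Uᵀ * U = 1)
    (X : Matrix (Fin N) (Fin N) ℝ) : hankelDet (U * X * Uᵀ) = hankelDet X := by
  simp only [hankelDet, conj_pow hU, trace_conj hU]

theorem hankelDet_diagonal (d : Fin N → ℝ) :
    hankelDet (diagonal d) = (vandermonde d).det ^ 2 := by
  have h : (Matrix.of fun i j : Fin N => ((diagonal d) ^ ((i : ℕ) + (j : ℕ))).trace) =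
      (vandermonde d)ᵀ * vandermonde d := by
    ext i j
    simp [diagonal_pow, trace_diagonal, mul_apply, vandermonde_apply, pow_add]
  rw [hankelDet, h, det_mul, det_transpose, sq]

theorem hankelDet_smul (a : ℝ) (X : Matrix (Fin N) (Fin N) ℝ) :
    hankelDet (a • X) = (∏ i : Fin N, a ^ (i : ℕ)) * ((∏ i : Fin N, a ^ (i : ℕ)) * hankelDet X) := by
  rw [hankelDet, hankelDet, ← det_mul_row, ← det_mul_column]
  congr 1
  ext i j
  simp [smul_pow, pow_add]
  ring

theorem continuous_hankelDet : Continuous (hankelDet (N := N)) := by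
  refine Continuous.matrix_det (continuous_matrix fun i j => ?_)
  exact (continuous_id.pow _).matrix_trace

theorem injective_of_hankelDet_ne_zero {U : Matrix (Fin N) (Fin N) ℝ} (hU : Uᵀ * U = 1)
    {d : Fin N → ℝ} (h : hankelDet (symOf (conjMap U (d, 0))) ≠ 0) : Function.Injective d := by
  rw [symOf_conjMap, hankelDet_conj hU, symOf_diag, hankelDet_diagonal] at h
  exact det_vandermonde_ne_zero_iff.1 fun h0 => h (by rw [h0]; ring)

/-- The discriminant restricts to a nonzero polynomial on every line parallel to a fixed matrix `e`
with simple spectrum. It therefore has finitely many zeros on each such line, and Fubini along `e`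
concludes. -/
theorem ae_hankelDet_ne_zero : ∀ᵐ p : SymCoord N, hankelDet (symOf p) ≠ 0 := by
  let e : SymCoord N := (fun i => ((i : ℕ) : ℝ), 0)
  have he : hankelDet (symOf e) ≠ 0 := by
    rw [symOf_diag, hankelDet_diagonal]
    refine pow_ne_zero _ (det_vandermonde_ne_zero_iff.2 fun i j h => ?_)
    exact Fin.ext (by exact_mod_cast h)
  have hmeas : MeasurableSet {p : SymCoord N | hankelDet (symOf p) ≠ 0} :=
    (isOpen_ne_fun (continuous_hankelDet.comp continuous_symOf) continuous_const).measurableSet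
  refine ae_mem_of_ae_add_linearMap_mem (LinearMap.toSpanSingleton ℝ (SymCoord N) e)
    (volume : Measure ℝ) volume hmeas fun p => ?_
  let P : Polynomial ℝ := (Matrix.of fun i j : Fin N =>
    (((symOf p).map Polynomial.C + (Polynomial.X : Polynomial ℝ) • (symOf e).map Polynomial.C) ^
      ((i : ℕ) + (j : ℕ))).trace).det
  have hP : ∀ t : ℝ, P.eval t = hankelDet (symOf (p + t • e)) := by
    intro t
    have h1 : ((symOf p).map Polynomial.C +
        (Polynomial.X : Polynomial ℝ) • (symOf e).map Polynomial.C).map (Polynomial.evalRingHom t) =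
        symOf (p + t • e) := by
      rw [map_add, map_smul]
      ext i j
      simp
      ring
    rw [← Polynomial.coe_evalRingHom, RingHom.map_det, hankelDet]
    congr 1
    ext i j
    rw [RingHom.mapMatrix_apply, map_apply, of_apply, of_apply, ← h1,
      ← RingHom.mapMatrix_apply (Polynomial.evalRingHom t), ← map_pow, RingHom.mapMatrix_apply]
    simp only [trace, map_sum, diag_apply, map_apply]
  -- The polynomial is nonzero far out on the line: for small `s ≠ 0` the discriminant at `s • p +
  -- e` is close to that at `e`, and by homogeneity it is a multiple of the value at `p + s⁻¹ • e`.
  have hP0 : P ≠ 0 := by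
    have hcont : Continuous fun s : ℝ => hankelDet (symOf (s • p + e)) :=
      continuous_hankelDet.comp (continuous_symOf.comp
        ((continuous_id.smul continuous_const).add continuous_const))
    have hev : ∀ᶠ s in nhds (0 : ℝ), hankelDet (symOf (s • p + e)) ≠ 0 :=
      hcont.continuousAt.eventually_ne (by simpa using he)
    have hev2 : ∀ᶠ s in nhdsWithin (0 : ℝ) {0}ᶜ, hankelDet (symOf (s • p + e)) ≠ 0 ∧ s ≠ 0 :=
      (hev.filter_mono nhdsWithin_le_nhds).and self_mem_nhdsWithin
    obtain ⟨s, hs, hs0⟩ := hev2.exists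
    intro h0
    have h1 := hP s⁻¹
    rw [h0, Polynomial.eval_zero] at h1
    have h2 : s • p + e = s • (p + s⁻¹ • e) := by
      rw [smul_add, smul_smul, mul_inv_cancel₀ hs0, one_smul]
    rw [h2, map_smul, hankelDet_smul, ← h1] at hs
    simp at hs
  have hfin : (P.rootSet ℝ).Finite := P.rootSet_finite ℝ
  have : ∀ᵐ t : ℝ, t ∉ P.rootSet ℝ := measure_eq_zero_iff_ae_notMem.1 (hfin.measure_zero _)
  filter_upwards [this] with t ht h0
  refine ht ((Polynomial.mem_rootSet_of_ne hP0).2 ?_)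
  rw [Polynomial.coe_aeval_eq_eval, hP]
  exact h0

/-- Averaging over the orthogonal group. -/
theorem exists_average_conj {S : Set (SymCoord N)} (hS : MeasurableSet S)
    (hSd : ∀ d d' : Fin N → ℝ, Function.Injective d → Function.Injective d' →
      ∀ U : orthogonalGroup (Fin N) ℝ, conjMap (U : Matrix (Fin N) (Fin N) ℝ)ᵀ (d, 0) ∈ S →
        conjMap (U : Matrix (Fin N) (Fin N) ℝ)ᵀ (d', 0) ∈ S) :
    ∃ a κ : ENNReal, a ≠ 0 ∧ a ≠ ⊤ ∧ κ ≠ ⊤ ∧ ∀ H : SymCoord N → ENNReal, Measurable H →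
      (∀ (U : orthogonalGroup (Fin N) ℝ) p, H (conjMap U p) = H p) →
        a * ∫⁻ p in S, H p = κ * ∫⁻ p, H p := by
  let _ : MeasurableSpace (orthogonalGroup (Fin N) ℝ) := borel _
  have : BorelSpace (orthogonalGroup (Fin N) ℝ) := ⟨rfl⟩
  have : SecondCountableTopology (orthogonalGroup (Fin N) ℝ) :=
    TopologicalSpace.Subtype.secondCountableTopology _
  let ν : Measure (orthogonalGroup (Fin N) ℝ) := Measure.haar
  let Φ : orthogonalGroup (Fin N) ℝ × SymCoord N → SymCoord N := fun q =>
    conjMap (q.1 : Matrix (Fin N) (Fin N) ℝ)ᵀ q.2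
  have hΦ : Continuous Φ := by
    have h1 : Continuous fun q : orthogonalGroup (Fin N) ℝ × SymCoord N =>
        (q.1 : Matrix (Fin N) (Fin N) ℝ) := continuous_subtype_val.comp continuous_fst
    exact continuous_coordOf.comp ((h1.matrix_transpose.matrix_mul
      (continuous_symOf.comp continuous_snd)).matrix_mul h1.matrix_transpose.matrix_transpose)
  -- An arbitrary reference spectrum. By `hSd`, the set of `U` conjugating `diag d` into `S` is the
  -- same for every injective `d`.
  let d₀ : Fin N → ℝ := fun i => ((i : ℕ) : ℝ)
  have hd₀ : Function.Injective d₀ := fun i j h => Fin.ext (Nat.cast_injective h)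
  refine ⟨ν Set.univ, ν {U | Φ (U, (d₀, 0)) ∈ S}, ?_, measure_ne_top _ _, measure_ne_top _ _,
    fun H hH hinv => ?_⟩
  · exact (isOpen_univ.measure_pos ν Set.univ_nonempty).ne'
  have hinv' : ∀ (U : orthogonalGroup (Fin N) ℝ) p,
      H (conjMap (U : Matrix (Fin N) (Fin N) ℝ)ᵀ p) = H p := fun U p => hinv U⁻¹ p
  have hmeas : Measurable fun q : orthogonalGroup (Fin N) ℝ × SymCoord N =>
      S.indicator 1 (Φ q) * H q.2 :=
    ((measurable_one.indicator hS).comp hΦ.measurable).mul (hH.comp measurable_snd)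
  -- One order of integration: for fixed `U`, conjugation preserves both volume and `H`.
  have h1 : ∀ U : orthogonalGroup (Fin N) ℝ,
      ∫⁻ p, S.indicator 1 (Φ (U, p)) * H p = ∫⁻ p in S, H p := by
    intro U
    have hU : (U : Matrix (Fin N) (Fin N) ℝ)ᵀᵀ * (U : Matrix (Fin N) (Fin N) ℝ)ᵀ = 1 := by
      rw [transpose_transpose]; exact orthogonal_mul_transpose U
    have h2 := (measurePreserving_conjMap hU).lintegral_comp
      (f := fun p => S.indicator 1 p * H p) ((measurable_one.indicator hS).mul hH)
    simp only [hinv'] at h2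
    rw [← lintegral_indicator hS]
    refine h2.trans (lintegral_congr fun p => ?_)
    by_cases hp : p ∈ S <;> simp [hp]
  -- The other order: diagonalizing `p` by `W` translates the set of admissible `U` by `W`, and left
  -- invariance of Haar measure removes the translation.
  have h3 : ∀ᵐ p : SymCoord N, ∫⁻ U, S.indicator 1 (Φ (U, p)) * H p ∂ν =
      ν {U | Φ (U, (d₀, 0)) ∈ S} * H p := by
    filter_upwards [ae_hankelDet_ne_zero] with p hp
    have hsec : Continuous fun U : orthogonalGroup (Fin N) ℝ => Φ (U, p) :=
      hΦ.comp (continuous_id.prodMk continuous_const)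
    rw [lintegral_mul_const (H p) (f := fun U => S.indicator (1 : SymCoord N → ENNReal) (Φ (U, p)))
      ((measurable_one.indicator hS).comp hsec.measurable)]
    congr 1
    have h4 : (fun U : orthogonalGroup (Fin N) ℝ => S.indicator (1 : SymCoord N → ENNReal)
        (Φ (U, p))) = ({U | Φ (U, p) ∈ S} : Set _).indicator 1 := rfl
    rw [h4]
    refine (lintegral_indicator_one (hsec.measurable hS)).trans ?_
    change ν {U | Φ (U, p) ∈ S} = _
    obtain ⟨W, hW⟩ := exists_eq_conjMap_eigenvalues (isHermitian_symOf p)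
    set d := (isHermitian_symOf p).eigenvalues
    clear_value d
    subst hW
    have hd := injective_of_hankelDet_ne_zero (orthogonal_transpose_mul W) hp
    have h5 : {U : orthogonalGroup (Fin N) ℝ | Φ (U, conjMap W (d, 0)) ∈ S} =
        (fun U => W⁻¹ * U) ⁻¹' {U | Φ (U, (d₀, 0)) ∈ S} := by
      ext U
      have h6 : Φ (U, conjMap W (d, 0)) =
          conjMap ((W⁻¹ * U : orthogonalGroup (Fin N) ℝ) : Matrix (Fin N) (Fin N) ℝ)ᵀ (d, 0) := by
        change conjMap _ (conjMap _ _) = _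
        rw [← conjMap_mul]
        change _ = conjMap ((W : Matrix (Fin N) (Fin N) ℝ)ᵀ * (U : Matrix (Fin N) (Fin N) ℝ))ᵀ (d, 0)
        rw [transpose_mul, transpose_transpose]
      simp only [Set.mem_ofPred_eq, Set.mem_preimage, h6]
      exact ⟨hSd _ _ hd hd₀ _, hSd _ _ hd₀ hd _⟩
    rw [h5, measure_preimage_mul]
  calc ν Set.univ * ∫⁻ p in S, H p = ∫⁻ U, (∫⁻ p, S.indicator 1 (Φ (U, p)) * H p) ∂ν := by
        simp_rw [h1]; rw [lintegral_const, mul_comm]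
    _ = ∫⁻ p : SymCoord N, (∫⁻ U, S.indicator 1 (Φ (U, p)) * H p ∂ν) := lintegral_lintegral_swap hmeas.aemeasurable
    _ = ∫⁻ p, ν {U | Φ (U, (d₀, 0)) ∈ S} * H p := lintegral_congr_ae h3
    _ = _ := lintegral_const_mul _ hH

end Orthogonal

/-! ### The Weyl integration formula -/

section Weyl

variable {N : ℕ}

theorem injective_iff_det_vandermonde (d : Fin N → ℝ) :
    Function.Injective d ↔ (vandermonde d).det ≠ 0 := det_vandermonde_ne_zero_iff.symm

theorem continuous_det_vandermonde : Continuous fun d : Fin N → ℝ => (vandermonde d).det :=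
  Continuous.matrix_det (continuous_matrix fun i _ => (continuous_apply i).pow _)

theorem isOpen_injective : IsOpen {d : Fin N → ℝ | Function.Injective d} := by
  simp only [injective_iff_det_vandermonde]
  exact isOpen_ne_fun continuous_det_vandermonde continuous_const

/-- Eigenvectors are determined only up to order and sign. Positive diagonal entries of the
transition matrices remove this ambiguity, and they persist near `k = 0` by continuity. -/
theorem exists_cayley_nhd : ∃ Ω : Set (UpperPairs N → ℝ), IsOpen Ω ∧ (0 : UpperPairs N → ℝ) ∈ Ω ∧
    ∀ k ∈ Ω, ∀ k' ∈ Ω, ∀ i, 0 < ((cayley k')ᵀ * cayley k) i i := by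
  have hev : ∀ i : Fin N, ∀ᶠ q in nhds ((0 : UpperPairs N → ℝ), (0 : UpperPairs N → ℝ)),
      0 < ((cayley q.2)ᵀ * cayley q.1) i i := by
    intro i
    have hc : Continuous fun q : (UpperPairs N → ℝ) × (UpperPairs N → ℝ) =>
        ((cayley q.2)ᵀ * cayley q.1) i i :=
      (((continuous_cayley.comp continuous_snd).matrix_transpose).matrix_mul
        (continuous_cayley.comp continuous_fst)).matrix_elem i i
    refine hc.continuousAt.eventually_const_lt ?_
    simp [cayley_zero]
  have hev' := Filter.eventually_all.2 hev
  rw [nhds_prod_eq] at hev'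
  obtain ⟨u, hu, huv⟩ := (Filter.eventually_prod_self_iff
    (r := fun k k' => ∀ i, 0 < ((cayley k')ᵀ * cayley k) i i)).1 hev'
  obtain ⟨Ω, hΩu, hΩ, h0⟩ := mem_nhds_iff.1 hu
  exact ⟨Ω, hΩ, h0, fun k hk k' hk' i => huv k (hΩu hk) k' (hΩu hk') i⟩

/-- The transition matrix `W` between two diagonalizations satisfies `W D = D' W`. Its nonzero
diagonal entries force `d = d'`, distinctness of the eigenvalues then makes `W` diagonal, and a
diagonal orthogonal matrix with positive entries is `1`. -/
theorem eigenChart_injOn {Ω : Set (UpperPairs N → ℝ)}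
    (hΩ : ∀ k ∈ Ω, ∀ k' ∈ Ω, ∀ i, 0 < ((cayley k')ᵀ * cayley k) i i) :
    Set.InjOn eigenChart ({d : Fin N → ℝ | Function.Injective d} ×ˢ Ω) := by
  rintro ⟨d, k⟩ ⟨hd, hk⟩ ⟨d', k'⟩ ⟨hd', hk'⟩ h
  have h1 : cayley k * diagonal d * (cayley k)ᵀ = cayley k' * diagonal d' * (cayley k')ᵀ := by
    rw [← symOf_eigenChart (d, k), ← symOf_eigenChart (d', k'), h]
  set W := (cayley k')ᵀ * cayley k with hW
  have h2 : W * diagonal d = diagonal d' * W := by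
    calc W * diagonal d = (cayley k')ᵀ * (cayley k * diagonal d * (cayley k)ᵀ) * cayley k := by
          rw [hW]
          simp only [mul_assoc, cayley_transpose_mul_cayley, mul_one]
      _ = diagonal d' * W := by
          rw [h1, hW, ← mul_assoc, ← mul_assoc, cayley_transpose_mul_cayley, one_mul, mul_assoc]
  have h3 : ∀ i j, W i j * d j = d' i * W i j := fun i j => by
    have := congrFun (congrFun h2 i) j
    rwa [mul_diagonal, diagonal_mul] at this
  have hpos : ∀ i, 0 < W i i := hΩ k hk k' hk'
  have hdd : d = d' := by
    funext i
    have := h3 i i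
    rw [mul_comm] at this
    exact mul_right_cancel₀ (hpos i).ne' this
  subst hdd
  have hoff : ∀ i j, i ≠ j → W i j = 0 := by
    intro i j hij
    by_contra h0
    have h4 := h3 i j
    rw [mul_comm] at h4
    exact hij (hd (mul_right_cancel₀ h0 h4)).symm
  have hWW : Wᵀ * W = 1 := by
    rw [hW, transpose_mul, transpose_transpose, mul_assoc, ← mul_assoc (cayley k'),
      cayley_mul_cayley_transpose, one_mul, cayley_transpose_mul_cayley]
  have hdiag : ∀ i, W i i = 1 := by
    intro i
    have h5 := congrFun (congrFun hWW i) i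
    rw [mul_apply, Finset.sum_eq_single i (fun j _ hj => by rw [hoff j i hj, mul_zero])
      (fun h => absurd (Finset.mem_univ i) h), transpose_apply, one_apply_eq] at h5
    nlinarith [hpos i]
  have hW1 : W = 1 := by
    ext i j
    by_cases hij : i = j
    · subst hij; rw [hdiag, one_apply_eq]
    · rw [hoff i j hij, one_apply_ne hij]
  have hc : cayley k = cayley k' := by
    rw [← one_mul (cayley k), ← cayley_mul_cayley_transpose k', mul_assoc, ← hW, hW1, mul_one]
  rw [cayley_injective hc]

/-- An orthogonal matrix that conjugates one diagonal matrix with simple spectrum to another has a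
single nonzero entry in each column. It is a signed permutation matrix and keeps every diagonal
matrix diagonal. -/
theorem exists_diagonal_of_diagonal {W : Matrix (Fin N) (Fin N) ℝ} (hW : Wᵀ * W = 1)
    {d d' e : Fin N → ℝ} (hd : Function.Injective d) (hd' : Function.Injective d')
    (he : Function.Injective e) (h : Wᵀ * diagonal d * W = diagonal e) :
    ∃ e', Function.Injective e' ∧ Wᵀ * diagonal d' * W = diagonal e' := by
  have hW' : W * Wᵀ = 1 := mul_eq_one_comm.1 hW
  have h1 : diagonal d * W = W * diagonal e := by
    rw [← h, ← mul_assoc, ← mul_assoc, hW', one_mul]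
  have h2 : ∀ i j, W i j ≠ 0 → d i = e j := fun i j h0 => by
    have := congrFun (congrFun h1 i) j
    rw [mul_diagonal, diagonal_mul, mul_comm] at this
    exact mul_left_cancel₀ h0 this
  have hcol : ∀ j, ∃ i, W i j ≠ 0 := by
    intro j
    by_contra hno
    push Not at hno
    have := congrFun (congrFun hW j) j
    rw [mul_apply, Finset.sum_eq_zero (fun i _ => by rw [hno i, mul_zero]), one_apply_eq] at this
    exact zero_ne_one this
  choose σ hσ using hcol
  refine ⟨d' ∘ σ, hd'.comp fun j j' hjj => ?_, ?_⟩
  · apply he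
    rw [← h2 _ _ (hσ j), ← h2 _ _ (hσ j'), hjj]
  · have h3 : diagonal d' * W = W * diagonal (d' ∘ σ) := by
      ext i j
      rw [mul_diagonal, diagonal_mul, mul_comm]
      by_cases h0 : W i j = 0
      · simp [h0]
      · have : i = σ j := hd ((h2 i j h0).trans (h2 _ _ (hσ j)).symm)
        rw [this]; rfl
    rw [mul_assoc, h3, ← mul_assoc, hW, one_mul]

/-- Whether a conjugate lies in the image of the chart depends only on the frame, not on the
eigenvalues. This is the hypothesis required by `exists_average_conj`. -/
theorem conjMap_mem_image {Ω : Set (UpperPairs N → ℝ)} {d d' : Fin N → ℝ}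
    (hd : Function.Injective d) (hd' : Function.Injective d') (U : orthogonalGroup (Fin N) ℝ)
    (h : conjMap (U : Matrix (Fin N) (Fin N) ℝ)ᵀ (d, 0) ∈
      eigenChart '' ({d : Fin N → ℝ | Function.Injective d} ×ˢ Ω)) :
    conjMap (U : Matrix (Fin N) (Fin N) ℝ)ᵀ (d', 0) ∈
      eigenChart '' ({d : Fin N → ℝ | Function.Injective d} ×ˢ Ω) := by
  obtain ⟨⟨e, k⟩, ⟨he, hk⟩, hek⟩ := h
  set W := (U : Matrix (Fin N) (Fin N) ℝ) * cayley k with hW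
  have hWW : Wᵀ * W = 1 := by
    rw [hW, transpose_mul, mul_assoc, ← mul_assoc _ (U : Matrix (Fin N) (Fin N) ℝ),
      orthogonal_transpose_mul, one_mul, cayley_transpose_mul_cayley]
  have h1 : Wᵀ * diagonal d * W = diagonal e := by
    have h2 := congrArg symOf hek
    rw [symOf_eigenChart, symOf_conjMap, symOf_diag, transpose_transpose] at h2
    have h3 : Wᵀ * diagonal d * W = (cayley k)ᵀ * ((U : Matrix (Fin N) (Fin N) ℝ)ᵀ * diagonal d *
        (U : Matrix (Fin N) (Fin N) ℝ)) * cayley k := by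
      rw [hW, transpose_mul]; simp only [mul_assoc]
    rw [h3, ← h2]
    simp only [mul_assoc, cayley_transpose_mul_cayley, mul_one]
    rw [← mul_assoc, cayley_transpose_mul_cayley, one_mul]
  obtain ⟨e', he', h4⟩ := exists_diagonal_of_diagonal hWW hd hd' he h1
  refine ⟨(e', k), ⟨he', hk⟩, ?_⟩
  rw [← coordOf_symOf (eigenChart _), ← coordOf_symOf (conjMap _ _), symOf_eigenChart,
    symOf_conjMap, symOf_diag, ← h4, hW, transpose_mul, transpose_transpose]
  congr 1
  calc cayley k * ((cayley k)ᵀ * (U : Matrix (Fin N) (Fin N) ℝ)ᵀ * diagonal d' *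
        ((U : Matrix (Fin N) (Fin N) ℝ) * cayley k)) * (cayley k)ᵀ
      = (cayley k * (cayley k)ᵀ) * (U : Matrix (Fin N) (Fin N) ℝ)ᵀ * diagonal d' *
        (U : Matrix (Fin N) (Fin N) ℝ) * (cayley k * (cayley k)ᵀ) := by simp only [mul_assoc]
    _ = _ := by rw [cayley_mul_cayley_transpose, one_mul, mul_one]

/-- The three factors of the derivative are an orthogonal conjugation of determinant `±1`,
multiplication by eigenvalue gaps, and the logarithmic derivative of the Cayley transform. -/
theorem abs_det_eigenChartDeriv (p : SymCoord N) :
    |(LinearMap.toContinuousLinearMap (eigenChartDeriv p)).det| =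
      |(vandermonde p.1).det| * cayleyJac p.2 := by
  rw [LinearMap.det_toContinuousLinearMap, eigenChartDeriv, LinearMap.det_comp, LinearMap.det_comp,
    LinearMap.det_prodMap, LinearMap.det_prodMap, LinearMap.det_id, one_mul, one_mul, det_gapMap,
    abs_mul, abs_mul, abs_det_conjMap (cayley_transpose_mul_cayley _), one_mul, cayleyJac]

theorem continuous_eigenChart : Continuous (eigenChart (N := N)) :=
  continuous_iff_continuousAt.2 fun p => (hasFDerivAt_eigenChart p).continuousAt

/-- The integral over the spectrum which appears in the Weyl integration formula. -/
noncomputable def spectralIntegral (H : SymCoord N → ENNReal) : ENNReal :=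
  ∫⁻ d : Fin N → ℝ, H (d, 0) * ENNReal.ofReal |(vandermonde d).det|

theorem lintegral_image_eigenChart {Ω : Set (UpperPairs N → ℝ)} (hΩo : IsOpen Ω)
    (hΩ : ∀ k ∈ Ω, ∀ k' ∈ Ω, ∀ i, 0 < ((cayley k')ᵀ * cayley k) i i)
    {H : SymCoord N → ENNReal} (hH : Measurable H)
    (hinv : ∀ (U : orthogonalGroup (Fin N) ℝ) p, H (conjMap U p) = H p) :
    ∫⁻ p in eigenChart '' ({d : Fin N → ℝ | Function.Injective d} ×ˢ Ω), H p =
      spectralIntegral H * ∫⁻ k in Ω, ENNReal.ofReal (cayleyJac k) := by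
  have hm : MeasurableSet ({d : Fin N → ℝ | Function.Injective d} ×ˢ Ω) :=
    isOpen_injective.measurableSet.prod hΩo.measurableSet
  rw [lintegral_image_eq_lintegral_abs_det_fderiv_mul volume hm
    (fun p _ => (hasFDerivAt_eigenChart p).hasFDerivWithinAt) (eigenChart_injOn hΩ)]
  have h1 : ∀ p : SymCoord N, ENNReal.ofReal
      |(LinearMap.toContinuousLinearMap (eigenChartDeriv p)).det| * H (eigenChart p) =
      (H (p.1, 0) * ENNReal.ofReal |(vandermonde p.1).det|) * ENNReal.ofReal (cayleyJac p.2) := by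
    intro p
    have h2 : H (eigenChart p) = H (p.1, 0) :=
      hinv ⟨cayley p.2, (mem_orthogonalGroup_iff _ _).2 (cayley_mul_cayley_transpose _)⟩ _
    rw [abs_det_eigenChartDeriv, h2, ENNReal.ofReal_mul (abs_nonneg _)]
    ring
  simp_rw [h1]
  have hmeas : Measurable fun d : Fin N → ℝ => H (d, 0) * ENNReal.ofReal |(vandermonde d).det| :=
    (hH.comp (measurable_id.prodMk measurable_const)).mul
      continuous_det_vandermonde.abs.measurable.ennreal_ofReal
  rw [Measure.volume_eq_prod, ← Measure.prod_restrict, lintegral_prod_mul hmeas.aemeasurable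
    continuous_cayleyJac.measurable.ennreal_ofReal.aemeasurable]
  congr 1
  rw [← lintegral_indicator isOpen_injective.measurableSet, spectralIntegral]
  refine lintegral_congr fun d => ?_
  by_cases hd : Function.Injective d
  · rw [Set.indicator_of_mem (show d ∈ {d : Fin N → ℝ | Function.Injective d} from hd)]
  · rw [Set.indicator_of_notMem (show d ∉ {d : Fin N → ℝ | Function.Injective d} from hd)]
    rw [injective_iff_det_vandermonde, not_not] at hd
    simp [hd]

theorem spectralIntegral_ball_ne_zero :
    spectralIntegral (({p : SymCoord N | sqNorm p ≤ 1} : Set _).indicator 1) ≠ 0 := by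
  have hcl : MeasurableSet {p : SymCoord N | sqNorm p ≤ 1} :=
    (isClosed_le continuous_sqNorm continuous_const).measurableSet
  have hemb : Continuous fun d : Fin N → ℝ => ((d, 0) : SymCoord N) :=
    continuous_id.prodMk continuous_const
  have hmeas : Measurable fun d : Fin N → ℝ =>
      ({p : SymCoord N | sqNorm p ≤ 1} : Set _).indicator (1 : SymCoord N → ENNReal) (d, 0) *
        ENNReal.ofReal |(vandermonde d).det| :=
    ((measurable_one.indicator hcl).comp hemb.measurable).mul
      continuous_det_vandermonde.abs.measurable.ennreal_ofReal
  let O : Set (Fin N → ℝ) := {d | sqNorm (d, 0) < 1} ∩ {d | Function.Injective d}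
  have hO : IsOpen O :=
    (isOpen_lt (continuous_sqNorm.comp hemb) continuous_const).inter isOpen_injective
  have hOne : O.Nonempty := by
    let d₀ : Fin N → ℝ := fun i => ((i : ℕ) : ℝ)
    have hd₀ : Function.Injective d₀ := fun i j h => Fin.ext (Nat.cast_injective h)
    have hc : Continuous fun s : ℝ => sqNorm ((s • d₀, 0) : SymCoord N) :=
      continuous_sqNorm.comp (hemb.comp (continuous_id.smul continuous_const))
    have hev : ∀ᶠ s in nhds (0 : ℝ), sqNorm ((s • d₀, 0) : SymCoord N) < 1 := by
      refine hc.continuousAt.eventually_lt_const ?_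
      simp [sqNorm, symOf_diag]
    have hev2 : ∀ᶠ s in nhdsWithin (0 : ℝ) {0}ᶜ, sqNorm ((s • d₀, 0) : SymCoord N) < 1 ∧ s ≠ 0 :=
      (hev.filter_mono nhdsWithin_le_nhds).and self_mem_nhdsWithin
    obtain ⟨s, hs, hs0⟩ := hev2.exists
    exact ⟨s • d₀, hs, fun i j h => hd₀ (mul_left_cancel₀ hs0 h)⟩
  intro h0
  rw [spectralIntegral, lintegral_eq_zero_iff hmeas] at h0
  have h1 : ∀ᵐ d : Fin N → ℝ, d ∉ O := by
    filter_upwards [h0] with d hd hdO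
    have h3 : ((d, 0) : SymCoord N) ∈ {p : SymCoord N | sqNorm p ≤ 1} := by
      have h4 : sqNorm ((d, 0) : SymCoord N) < 1 := hdO.1
      exact h4.le
    rw [Set.indicator_of_mem h3] at hd
    simp at hd
    exact (injective_iff_det_vandermonde d).1 hdO.2 hd
  exact (hO.measure_pos volume hOne).ne' (measure_eq_zero_iff_ae_notMem.2 h1)

/-- The Weyl integration formula for real symmetric matrices, in coordinates. -/
theorem exists_weyl_coord (N : ℕ) : ∃ c : ENNReal, c ≠ 0 ∧ c ≠ ⊤ ∧
    ∀ H : SymCoord N → ENNReal, Measurable H →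
      (∀ (U : orthogonalGroup (Fin N) ℝ) p, H (conjMap U p) = H p) →
        ∫⁻ p, H p = c * spectralIntegral H := by
  obtain ⟨Ω, hΩo, h0, hΩ⟩ := exists_cayley_nhd (N := N)
  have hm : MeasurableSet ({d : Fin N → ℝ | Function.Injective d} ×ˢ Ω) :=
    isOpen_injective.measurableSet.prod hΩo.measurableSet
  have hS : MeasurableSet (eigenChart '' ({d : Fin N → ℝ | Function.Injective d} ×ˢ Ω)) :=
    hm.image_of_continuousOn_injOn continuous_eigenChart.continuousOn (eigenChart_injOn hΩ)
  obtain ⟨a, κ, ha0, ha, hκ, key⟩ := exists_average_conj hS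
    (fun d d' hd hd' U h => conjMap_mem_image hd hd' U h)
  set J := ∫⁻ k in Ω, ENNReal.ofReal (cayleyJac k) with hJ
  have hJ0 : J ≠ 0 := by
    intro hJz
    rw [hJ, lintegral_eq_zero_iff continuous_cayleyJac.measurable.ennreal_ofReal] at hJz
    let O : Set (UpperPairs N → ℝ) := Ω ∩ {k | 0 < cayleyJac k}
    have hO : IsOpen O := hΩo.inter (isOpen_lt continuous_const continuous_cayleyJac)
    have h1 := (ae_restrict_iff' hΩo.measurableSet).1 hJz
    have h2 : ∀ᵐ k : UpperPairs N → ℝ, k ∉ O := by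
      filter_upwards [h1] with k hk hkO
      have := hk hkO.1
      simp only [Pi.zero_apply, ENNReal.ofReal_eq_zero] at this
      exact absurd hkO.2 (not_lt.2 this)
    exact (hO.measure_pos volume ⟨0, h0, cayleyJac_zero_pos⟩).ne'
      (measure_eq_zero_iff_ae_notMem.2 h2)
  have key' : ∀ H : SymCoord N → ENNReal, Measurable H →
      (∀ (U : orthogonalGroup (Fin N) ℝ) p, H (conjMap U p) = H p) →
        a * (spectralIntegral H * J) = κ * ∫⁻ p, H p := fun H hH hinv => by
    rw [← key H hH hinv, lintegral_image_eigenChart hΩo hΩ hH hinv]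
  have hcl : MeasurableSet {p : SymCoord N | sqNorm p ≤ 1} :=
    (isClosed_le continuous_sqNorm continuous_const).measurableSet
  -- Testing on the unit ball, whose volume is positive and finite, excludes `J = ⊤` and `κ = 0`.
  -- Neither is clear beforehand, since `Ω` need not be bounded.
  have hball := key' (({p : SymCoord N | sqNorm p ≤ 1} : Set _).indicator 1)
    (measurable_one.indicator hcl) (fun U p => by
      simp only [Set.indicator, Set.mem_ofPred_eq, sqNorm_conjMap (orthogonal_transpose_mul U)]
      rfl)
  rw [lintegral_indicator_one hcl] at hball
  have hB := spectralIntegral_ball_ne_zero (N := N)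
  have hJt : J ≠ ⊤ := by
    intro hJt
    rw [hJt, ENNReal.mul_top hB, ENNReal.mul_top ha0] at hball
    exact ENNReal.mul_ne_top hκ volume_sqNorm_le.2 hball.symm
  have hκ0 : κ ≠ 0 := by
    intro hκ0
    rw [hκ0, zero_mul] at hball
    exact mul_ne_zero ha0 (mul_ne_zero hB hJ0) hball
  refine ⟨κ⁻¹ * (a * J), mul_ne_zero (ENNReal.inv_ne_zero.2 hκ) (mul_ne_zero ha0 hJ0),
    ENNReal.mul_ne_top (ENNReal.inv_ne_top.2 hκ0) (ENNReal.mul_ne_top ha hJt),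
    fun H hH hinv => ?_⟩
  have h1 := key' H hH hinv
  calc ∫⁻ p, H p = κ⁻¹ * (κ * ∫⁻ p, H p) := by
        rw [← mul_assoc, ENNReal.inv_mul_cancel hκ0 hκ, one_mul]
    _ = _ := by rw [← h1]; ring

end Weyl

/-! ### Symmetric functions of the eigenvalues -/

section Eigenvalues

variable {N : ℕ}

/-- The values of the characteristic polynomial at the natural numbers. -/
noncomputable def charValues (p : SymCoord N) (m : ℕ) : ℝ :=
  ((m : ℝ) • (1 : Matrix (Fin N) (Fin N) ℝ) - symOf p).det

theorem continuous_charValues : Continuous (charValues (N := N)) :=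
  continuous_pi fun _ => (continuous_const.sub continuous_symOf).matrix_det

theorem charValues_diag (d : Fin N → ℝ) (m : ℕ) : charValues (d, 0) m = ∏ i, ((m : ℝ) - d i) := by
  rw [charValues, symOf_diag, smul_one_eq_diagonal, diagonal_sub, det_diagonal]

theorem charValues_conjMap (U : orthogonalGroup (Fin N) ℝ) (p : SymCoord N) :
    charValues (conjMap U p) = charValues p := by
  funext m
  have h : (m : ℝ) • (1 : Matrix (Fin N) (Fin N) ℝ) - symOf (conjMap U p) =
      (U : Matrix (Fin N) (Fin N) ℝ) * ((m : ℝ) • 1 - symOf p) *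
        (U : Matrix (Fin N) (Fin N) ℝ)ᵀ := by
    rw [symOf_conjMap, mul_sub, sub_mul, Matrix.mul_smul, Matrix.smul_mul, mul_one,
      orthogonal_mul_transpose]
  rw [charValues, h, det_mul, det_mul, mul_comm, ← mul_assoc, ← det_mul,
    orthogonal_transpose_mul, det_one, one_mul, charValues]

/-- Two polynomials that agree at all natural numbers coincide, hence have the same roots. Countably
many values suffice, so the invariant takes values in the Polish space `ℕ → ℝ`. -/
theorem range_eq_of_charValues_eq {d d' : Fin N → ℝ}
    (h : charValues (d, 0) = charValues (d', 0)) : Set.range d = Set.range d' := by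
  let P : (Fin N → ℝ) → Polynomial ℝ := fun d => ∏ i, (Polynomial.X - Polynomial.C (d i))
  have hP : P d = P d' := by
    refine Polynomial.eq_of_infinite_eval_eq _ _ ?_
    refine (Set.infinite_range_of_injective (Nat.cast_injective (R := ℝ))).mono ?_
    rintro _ ⟨m, rfl⟩
    have := congrFun h m
    rw [charValues_diag, charValues_diag] at this
    simpa [P, Polynomial.eval_prod] using this
  have hr : ∀ d : Fin N → ℝ, Set.range d = {x | (P d).eval x = 0} := by
    intro d
    ext x
    simp only [Set.mem_range, P, Polynomial.eval_prod, Set.mem_ofPred_eq, Finset.prod_eq_zero_iff,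
      Finset.mem_univ, true_and, Polynomial.eval_sub, Polynomial.eval_X, Polynomial.eval_C,
      sub_eq_zero]
    exact exists_congr fun _ => eq_comm
  rw [hr, hr, hP]

/-- A symmetric function of the eigenvalues is a measurable function of the matrix, up to matrices
with repeated eigenvalues. -/
theorem exists_measurable_of_symmetric {f : (Fin N → ℝ) → ENNReal} (hf : Measurable f)
    (hsymm : ∀ (σ : Equiv.Perm (Fin N)) d, f (d ∘ σ) = f d) :
    ∃ H : SymCoord N → ENNReal, Measurable H ∧
      (∀ (U : orthogonalGroup (Fin N) ℝ) p, H (conjMap U p) = H p) ∧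
      ∀ d, Function.Injective d → H (d, 0) = f d := by
  let C : Set (Fin N → ℝ) := {d | StrictMono d}
  have hC : MeasurableSet C := by
    have : C = ⋂ i : Fin N, ⋂ j : Fin N, {d | i < j → d i < d j} := by
      ext d; simp [C, StrictMono]
    rw [this]
    refine MeasurableSet.iInter fun i => MeasurableSet.iInter fun j => ?_
    by_cases hij : i < j
    · simpa [hij] using measurableSet_lt (measurable_pi_apply i) (measurable_pi_apply j)
    · simp [hij]
  let ρ : (Fin N → ℝ) → ℕ → ℝ := fun d => charValues (d, 0)
  have hρ : Continuous ρ := continuous_charValues.comp (continuous_id.prodMk continuous_const)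
  have hinj : Set.InjOn ρ C := by
    intro d hd d' hd' h
    exact (StrictMono.range_inj hd hd').1 (range_eq_of_charValues_eq h)
  -- Lusin–Souslin: a continuous injective map on a Borel set is a measurable embedding. Thus `f` on
  -- increasing tuples factors measurably through `charValues`, and measurability of the eigenvalues
  -- themselves is not needed.
  have hemb := hρ.continuousOn.measurableEmbedding hC hinj
  obtain ⟨g, hg, hgf⟩ := hemb.exists_measurable_extend (hf.comp measurable_subtype_coe)
    (fun _ => ⟨(0 : ENNReal)⟩)
  refine ⟨fun p => g (charValues p), hg.comp continuous_charValues.measurable, fun U p => by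
    simp only [charValues_conjMap], fun d hd => ?_⟩
  obtain ⟨σ, hσ⟩ := exists_strictMono_comp hd
  have h1 : charValues (d, 0) = charValues (d ∘ σ, 0) := by
    funext m
    rw [charValues_diag, charValues_diag]
    exact (Equiv.prod_comp σ (fun i => (m : ℝ) - d i)).symm
  have h2 := congrFun hgf ⟨d ∘ σ, hσ⟩
  rw [← hsymm σ d]
  simp only [h1]
  exact h2

/-- The Weyl integration formula for symmetric functions of the eigenvalues. -/
theorem exists_weyl_symmetric (N : ℕ) : ∃ c : ENNReal, c ≠ 0 ∧ c ≠ ⊤ ∧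
    ∀ f : (Fin N → ℝ) → ENNReal, Measurable f →
      (∀ (σ : Equiv.Perm (Fin N)) d, f (d ∘ σ) = f d) →
      ∃ H : SymCoord N → ENNReal, Measurable H ∧
        (∀ᵐ p : SymCoord N, H p = f (isHermitian_symOf p).eigenvalues) ∧
        ∫⁻ p, H p = c * ∫⁻ d : Fin N → ℝ, f d * ENNReal.ofReal |(vandermonde d).det| := by
  obtain ⟨c, hc0, hct, hc⟩ := exists_weyl_coord N
  refine ⟨c, hc0, hct, fun f hf hsymm => ?_⟩
  obtain ⟨H, hH, hinv, hHf⟩ := exists_measurable_of_symmetric hf hsymm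
  refine ⟨H, hH, ?_, ?_⟩
  · filter_upwards [ae_hankelDet_ne_zero] with p hp
    obtain ⟨U, hU⟩ := exists_eq_conjMap_eigenvalues (isHermitian_symOf p)
    rw [hU] at hp
    have hd := injective_of_hankelDet_ne_zero (orthogonal_transpose_mul U) hp
    rw [← hHf _ hd, ← hinv U (_, 0), ← hU]
  · rw [hc H hH hinv, spectralIntegral]
    congr 1
    refine lintegral_congr fun d => ?_
    by_cases hd : Function.Injective d
    · rw [hHf d hd]
    · rw [injective_iff_det_vandermonde, not_not] at hd
      simp [hd]

end Eigenvalues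

/-! ### The matrix weight in terms of eigenvalues -/

section Weight

variable {N : ℕ}

/-- In an eigenbasis every term is diagonal, so summability at each eigenvalue makes the matrix
series converge and its `tsum` a true sum. -/
theorem trace_cfc_add_tsum (V : ℝ → ℝ) (t : ℕ+ → ℝ) {X : Matrix (Fin N) (Fin N) ℝ}
    (hX : X.IsHermitian)
    (hs : ∀ j, Summable fun i : ℕ+ => t i * hX.eigenvalues j ^ (i : ℕ)) :
    (cfc V X + ∑' i : ℕ+, t i • X ^ (i : ℕ)).trace =
      ∑ j, (V (hX.eigenvalues j) + ∑' i : ℕ+, t i * hX.eigenvalues j ^ (i : ℕ)) := by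
  let U : orthogonalGroup (Fin N) ℝ := hX.eigenvectorUnitary
  have hUX : X = (U : Matrix (Fin N) (Fin N) ℝ) * diagonal hX.eigenvalues *
      (U : Matrix (Fin N) (Fin N) ℝ)ᵀ := by
    have h1 := hX.spectral_theorem
    rw [Unitary.conjStarAlgAut_apply] at h1
    exact h1
  have hcfc : cfc V X = (U : Matrix (Fin N) (Fin N) ℝ) * diagonal (V ∘ hX.eigenvalues) *
      (U : Matrix (Fin N) (Fin N) ℝ)ᵀ := by
    rw [hX.cfc_eq, IsHermitian.cfc, Unitary.conjStarAlgAut_apply]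
    rfl
  have hpow : ∀ i : ℕ+, t i • X ^ (i : ℕ) = (U : Matrix (Fin N) (Fin N) ℝ) *
      diagonal (fun j => t i * hX.eigenvalues j ^ (i : ℕ)) *
      (U : Matrix (Fin N) (Fin N) ℝ)ᵀ := by
    intro i
    conv_lhs => rw [hUX]
    rw [conj_pow (orthogonal_transpose_mul U), diagonal_pow, ← Matrix.smul_mul, ← Matrix.mul_smul,
      ← diagonal_smul]
    rfl
  have hsum : HasSum (fun i : ℕ+ => t i • X ^ (i : ℕ)) ((U : Matrix (Fin N) (Fin N) ℝ) *
      diagonal (fun j => ∑' i : ℕ+, t i * hX.eigenvalues j ^ (i : ℕ)) *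
      (U : Matrix (Fin N) (Fin N) ℝ)ᵀ) := by
    simp_rw [hpow]
    have h2 : HasSum (fun (i : ℕ+) (j : Fin N) => t i * hX.eigenvalues j ^ (i : ℕ))
        (fun j => ∑' i : ℕ+, t i * hX.eigenvalues j ^ (i : ℕ)) :=
      Pi.hasSum.2 fun j => (hs j).hasSum
    exact (h2.matrix_diagonal.mul_left _).mul_right _
  rw [hsum.tsum_eq, hcfc, trace_add, trace_conj (orthogonal_transpose_mul U),
    trace_conj (orthogonal_transpose_mul U), trace_diagonal, trace_diagonal,
    ← Finset.sum_add_distrib]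
  rfl

theorem matrixWeight_eq_prod (V : ℝ → ℝ) (t : ℕ+ → ℝ) (X : symMatrices N)
    (hX : (X : Matrix (Fin N) (Fin N) ℝ).IsHermitian)
    (hs : ∀ j, Summable fun i : ℕ+ => t i * hX.eigenvalues j ^ (i : ℕ)) :
    matrixWeight V t X = ∏ j, lineWeight V t (hX.eigenvalues j) := by
  rw [matrixWeight, trace_cfc_add_tsum V t hX hs, Real.exp_sum]
  rfl

theorem mem_symWithSpectrumIn_iff {E : Set ℝ} (X : symMatrices N)
    (hX : (X : Matrix (Fin N) (Fin N) ℝ).IsHermitian) :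
    X ∈ symWithSpectrumIn N E ↔ ∀ j, hX.eigenvalues j ∈ E := by
  change spectrum ℝ (X : Matrix (Fin N) (Fin N) ℝ) ⊆ E ↔ _
  rw [hX.spectrum_real_eq_range_eigenvalues, Set.range_subset_iff]

/-- The series is only an almost everywhere limit of its partial sums. A measurable representative
is chosen, with one Borel null set `Z` containing all the exceptions. -/
theorem exists_measurable_weight {V : ℝ → ℝ} {E : Set ℝ} {l : ℕ} {t : ℕ+ → ℝ} (hV : Measurable V)
    (hE : MeasurableSet E) (ht : Converges V E l t) :
    ∃ w : ℝ → ENNReal, Measurable w ∧ ∃ Z : Set ℝ, MeasurableSet Z ∧ volume Z = 0 ∧ ∀ x, x ∉ Z →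
      w x = E.indicator (fun x => ENNReal.ofReal (lineWeight V t x)) x ∧
        (x ∈ E → Summable fun i : ℕ+ => t i * x ^ (i : ℕ)) := by
  have h1 : AEMeasurable (fun x => ∑' i : ℕ+, t i * x ^ (i : ℕ)) (volume.restrict E) := by
    refine aemeasurable_of_tendsto_metrizable_ae (Filter.atTop : Filter (Finset ℕ+))
      (f := fun s x => ∑ i ∈ s, t i * x ^ (i : ℕ)) (fun s => ?_) ?_
    · exact (Finset.measurable_sum s fun i _ =>
        (measurable_id.pow_const _).const_mul _).aemeasurable
    · filter_upwards [ht.1] with x hx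
      exact hx.hasSum
  have h2 : AEMeasurable (E.indicator fun x => ENNReal.ofReal (lineWeight V t x)) volume := by
    rw [aemeasurable_indicator_iff hE]
    exact (Real.measurable_exp.comp_aemeasurable (hV.aemeasurable.add h1)).ennreal_ofReal
  have h3 := (ae_restrict_iff' hE).1 ht.1
  have h4 : ∀ᵐ x : ℝ, h2.mk _ x = E.indicator (fun x => ENNReal.ofReal (lineWeight V t x)) x ∧
      (x ∈ E → Summable fun i : ℕ+ => t i * x ^ (i : ℕ)) := by
    filter_upwards [h2.ae_eq_mk, h3] with x hx hx'
    exact ⟨hx.symm, hx'⟩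
  refine ⟨h2.mk _, h2.measurable_mk, toMeasurable volume _, measurableSet_toMeasurable _ _,
    (measure_toMeasurable _).trans (ae_iff.1 h4), fun x hx => ?_⟩
  by_contra h
  exact hx (subset_toMeasurable _ _ h)

end Weight

/-! ### Haar measure on symmetric matrices and the matrix integral -/

section SymMatrices

variable {N : ℕ}

/-- The coordinates on the space of symmetric matrices. -/
noncomputable def symCoordEquiv (N : ℕ) : SymCoord N ≃L[ℝ] symMatrices N :=
  LinearEquiv.toContinuousLinearEquiv
    { toFun := fun p => ⟨symOf p, symOf_transpose p⟩
      invFun := fun X => coordOf (X : Matrix (Fin N) (Fin N) ℝ)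
      map_add' := fun p q => Subtype.ext (map_add symOf p q)
      map_smul' := fun a p => Subtype.ext (map_smul symOf a p)
      left_inv := coordOf_symOf
      right_inv := fun X => Subtype.ext (symOf_coordOf X.2) }

/-- A Haar measure on symmetric matrices is a multiple of Lebesgue measure in coordinates. -/
theorem exists_map_symCoordEquiv (dX : Measure (symMatrices N)) [dX.IsAddHaarMeasure] :
    ∃ a : ENNReal, a ≠ 0 ∧ a ≠ ⊤ ∧ dX = a • (volume : Measure (SymCoord N)).map (symCoordEquiv N) := by
  have h1 : (dX.map (symCoordEquiv N).symm).IsAddHaarMeasure :=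
    (symCoordEquiv N).symm.isAddHaarMeasure_map dX
  have h2 := Measure.isAddLeftInvariant_eq_smul (dX.map (symCoordEquiv N).symm)
    (volume : Measure (SymCoord N))
  obtain ⟨a, ha0, ha, h⟩ : ∃ a : ENNReal, a ≠ 0 ∧ a ≠ ⊤ ∧
      dX.map (symCoordEquiv N).symm = a • (volume : Measure (SymCoord N)) :=
    ⟨_, by exact_mod_cast (Measure.addHaarScalarFactor_pos_of_isAddHaarMeasure _ _).ne',
      ENNReal.coe_ne_top, h2⟩
  refine ⟨a, ha0, ha, ?_⟩
  rw [← Measure.map_smul, ← h, Measure.map_map (symCoordEquiv N).continuous.measurable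
    (symCoordEquiv N).symm.continuous.measurable]
  have : (symCoordEquiv N : SymCoord N → symMatrices N) ∘ (symCoordEquiv N).symm = id := by
    funext X; simp
  rw [this, Measure.map_id]

variable {V : ℝ → ℝ} {E : Set ℝ} {t : ℕ+ → ℝ}

theorem lineWeight_nonneg (V : ℝ → ℝ) (t : ℕ+ → ℝ) (x : ℝ) : 0 ≤ lineWeight V t x :=
  (Real.exp_pos _).le

theorem matrixWeight_nonneg (V : ℝ → ℝ) (t : ℕ+ → ℝ) (X : symMatrices N) :
    0 ≤ matrixWeight V t X := (Real.exp_pos _).le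

/-- The Weyl formula is applied to the indicator of tuples meeting `Z`, whose spectral integral is
zero. -/
theorem ae_eigenvalues_notMem (N : ℕ) {Z : Set ℝ} (hZ : MeasurableSet Z) (hZ0 : volume Z = 0) :
    ∀ᵐ p : SymCoord N, ∀ i, (isHermitian_symOf p).eigenvalues i ∉ Z := by
  obtain ⟨c, hc0, hct, hc⟩ := exists_weyl_symmetric N
  let B : Set (Fin N → ℝ) := {d | ∃ i, d i ∈ Z}
  have hB : MeasurableSet B := by
    have : B = ⋃ i, (fun d : Fin N → ℝ => d i) ⁻¹' Z := by ext d; simp [B]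
    rw [this]
    exact MeasurableSet.iUnion fun i => measurable_pi_apply i hZ
  obtain ⟨H, hH, hHae, hint⟩ := hc (B.indicator 1) (measurable_one.indicator hB) (fun σ d => by
    have : d ∘ σ ∈ B ↔ d ∈ B :=
      ⟨fun ⟨i, hi⟩ => ⟨σ i, hi⟩, fun ⟨i, hi⟩ => ⟨σ.symm i, by simpa using hi⟩⟩
    by_cases hd : d ∈ B
    · rw [Set.indicator_of_mem (this.2 hd), Set.indicator_of_mem hd]; rfl
    · rw [Set.indicator_of_notMem (mt this.1 hd), Set.indicator_of_notMem hd])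
  have hBae : ∀ᵐ d : Fin N → ℝ, d ∉ B := by
    have h1 : ∀ i : Fin N, ∀ᵐ d : Fin N → ℝ, d i ∉ Z := fun i =>
      (Measure.quasiMeasurePreserving_eval (fun _ : Fin N => (volume : Measure ℝ)) i).ae
        (measure_eq_zero_iff_ae_notMem.1 hZ0)
    filter_upwards [ae_all_iff.2 h1] with d hd
    rintro ⟨i, hi⟩
    exact hd i hi
  have h0 : ∫⁻ d : Fin N → ℝ, B.indicator 1 d * ENNReal.ofReal |(vandermonde d).det| = 0 := by
    rw [← lintegral_zero (μ := (volume : Measure (Fin N → ℝ)))]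
    refine lintegral_congr_ae ?_
    filter_upwards [hBae] with d hd
    simp [hd]
  rw [h0, mul_zero, lintegral_eq_zero_iff hH] at hint
  filter_upwards [hint, hHae] with p hp hp' i hi
  rw [hp] at hp'
  have : (isHermitian_symOf p).eigenvalues ∈ B := ⟨i, hi⟩
  rw [Set.indicator_of_mem this] at hp'
  simp at hp'

theorem indicator_symWithSpectrumIn (p : SymCoord N)
    (hs : ∀ i, (isHermitian_symOf p).eigenvalues i ∈ E →
      Summable fun k : ℕ+ => t k * (isHermitian_symOf p).eigenvalues i ^ (k : ℕ)) :
    (symWithSpectrumIn N E).indicator (fun X => ENNReal.ofReal (matrixWeight V t X))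
        (symCoordEquiv N p) =
      ∏ i, E.indicator (fun x => ENNReal.ofReal (lineWeight V t x))
        ((isHermitian_symOf p).eigenvalues i) := by
  have hX : ((symCoordEquiv N p : symMatrices N) : Matrix (Fin N) (Fin N) ℝ).IsHermitian :=
    isHermitian_symOf p
  by_cases h : symCoordEquiv N p ∈ symWithSpectrumIn N E
  · rw [Set.indicator_of_mem h]
    have hE := (mem_symWithSpectrumIn_iff _ hX).1 h
    rw [matrixWeight_eq_prod V t _ hX (fun j => hs j (hE j)),
      ENNReal.ofReal_prod_of_nonneg (fun i _ => lineWeight_nonneg V t _)]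
    exact Finset.prod_congr rfl fun i _ => (Set.indicator_of_mem (hE i)
      (fun x => ENNReal.ofReal (lineWeight V t x))).symm
  · rw [Set.indicator_of_notMem h]
    rw [mem_symWithSpectrumIn_iff _ hX] at h
    push Not at h
    obtain ⟨j, hj⟩ := h
    exact (Finset.prod_eq_zero (Finset.mem_univ j) (Set.indicator_of_notMem hj _)).symm

/-- The symmetric matrix integral as an integral over the spectrum. -/
theorem exists_matrix_integral_eq (N : ℕ) (dX : Measure (symMatrices N)) [dX.IsAddHaarMeasure] :
    ∃ b : ENNReal, b ≠ 0 ∧ b ≠ ⊤ ∧ ∀ (V : ℝ → ℝ) (E : Set ℝ) (l : ℕ) (t : ℕ+ → ℝ), Measurable V →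
      MeasurableSet E → Converges V E l t →
      AEMeasurable (fun X => matrixWeight V t X) (dX.restrict (symWithSpectrumIn N E)) ∧
      ∫⁻ X in symWithSpectrumIn N E, ENNReal.ofReal (matrixWeight V t X) ∂dX =
        b * ∫⁻ x : Fin N → ℝ, ENNReal.ofReal (|(vandermonde x).det| * ∏ i, lineWeight V t (x i))
          ∂(Measure.pi fun _ => volume.restrict E) := by
  obtain ⟨a, ha0, hat, ha⟩ := exists_map_symCoordEquiv dX
  obtain ⟨c, hc0, hct, hc⟩ := exists_weyl_symmetric N
  refine ⟨a * c, mul_ne_zero ha0 hc0, ENNReal.mul_ne_top hat hct, fun V E l t hV hE ht => ?_⟩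
  obtain ⟨w, hw, Z, hZ, hZ0, hwZ⟩ := exists_measurable_weight hV hE ht
  obtain ⟨H, hH, hHae, hint⟩ := hc (fun d => ∏ i, w (d i))
    (Finset.measurable_prod _ fun i _ => hw.comp (measurable_pi_apply i))
    (fun σ d => Equiv.prod_comp σ fun i => w (d i))
  set S := symWithSpectrumIn N E
  let g : symMatrices N → ENNReal := S.indicator fun X => ENNReal.ofReal (matrixWeight V t X)
  have hemb : MeasurableEmbedding (symCoordEquiv N) :=
    (symCoordEquiv N).toHomeomorph.measurableEmbedding
  have hg : ∀ᵐ p : SymCoord N, g (symCoordEquiv N p) = H p := by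
    filter_upwards [hHae, ae_eigenvalues_notMem N hZ hZ0] with p hp hpZ
    rw [hp]
    refine (indicator_symWithSpectrumIn p fun i => (hwZ _ (hpZ i)).2).trans ?_
    exact Finset.prod_congr rfl fun i _ => ((hwZ _ (hpZ i)).1).symm
  have hgae : g =ᵐ[dX] fun X => H ((symCoordEquiv N).symm X) := by
    rw [ha]
    refine Measure.ae_smul_measure ?_ a
    refine hemb.ae_map_iff.2 ?_
    filter_upwards [hg] with p hp
    simpa using hp
  have hHm : Measurable fun X => H ((symCoordEquiv N).symm X) :=
    hH.comp (symCoordEquiv N).symm.continuous.measurable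
  -- The weight is an exponential, hence never zero, so `S` agrees almost everywhere with the
  -- nonvanishing set of the measurable function `H`.
  have hS : NullMeasurableSet S dX := by
    have h1 : MeasurableSet {X | H ((symCoordEquiv N).symm X) ≠ 0} :=
      hHm (measurableSet_singleton 0).compl
    refine h1.nullMeasurableSet.congr ?_
    filter_upwards [hgae] with X hX
    refine propext ?_
    change H ((symCoordEquiv N).symm X) ≠ 0 ↔ X ∈ S
    rw [← hX]
    by_cases hXS : X ∈ S
    · simp [g, hXS, matrixWeight, Real.exp_pos]
    · simp [g, hXS]
  have hgS : g =ᵐ[dX.restrict S] fun X => ENNReal.ofReal (matrixWeight V t X) := by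
    filter_upwards [ae_restrict_mem₀ hS] with X hX
    exact Set.indicator_of_mem hX _
  constructor
  · refine (hHm.ennreal_toReal.aemeasurable (μ := dX.restrict S)).congr ?_
    filter_upwards [hgS, ae_restrict_of_ae hgae] with X h1 h2
    rw [← h2, h1, ENNReal.toReal_ofReal (matrixWeight_nonneg V t X)]
  · rw [← lintegral_indicator₀ hS]
    change ∫⁻ X, g X ∂dX = _
    have h1 : ∫⁻ X, H ((symCoordEquiv N).symm X) ∂dX = a * ∫⁻ p, H p := by
      rw [ha, lintegral_smul_measure, hemb.lintegral_map]
      simp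
    rw [lintegral_congr_ae hgae, h1, hint, mul_assoc]
    congr 2
    have h2 : ∀ᵐ d : Fin N → ℝ, ∀ i, d i ∉ Z := by
      refine ae_all_iff.2 fun i =>
        (Measure.quasiMeasurePreserving_eval (fun _ : Fin N => (volume : Measure ℝ)) i).ae
          (measure_eq_zero_iff_ae_notMem.1 hZ0)
    rw [← Measure.restrict_pi_pi, ← volume_pi,
      ← lintegral_indicator (MeasurableSet.univ_pi fun _ => hE)]
    refine lintegral_congr_ae ?_
    filter_upwards [h2] with d hd
    rw [Finset.prod_congr rfl fun i _ => (hwZ _ (hd i)).1]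
    by_cases hdE : d ∈ Set.univ.pi fun _ : Fin N => E
    · rw [Set.indicator_of_mem hdE, ENNReal.ofReal_mul (abs_nonneg _), mul_comm,
        ENNReal.ofReal_prod_of_nonneg (fun i _ => lineWeight_nonneg V t _)]
      congr 1
      exact Finset.prod_congr rfl fun i _ => Set.indicator_of_mem (hdE i (Set.mem_univ i)) _
    · rw [Set.indicator_of_notMem hdE]
      simp only [Set.mem_univ_pi, not_forall] at hdE
      obtain ⟨i, hi⟩ := hdE
      rw [Finset.prod_eq_zero (Finset.mem_univ i) (Set.indicator_of_notMem hi _), zero_mul]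

theorem pfaffianTau_eq_matrix_integral (n : ℕ) (dX : Measure (symMatrices (2 * n)))
    [dX.IsAddHaarMeasure] :
    ∃ c : ℝ, 0 < c ∧ ∀ (V : ℝ → ℝ) (E : Set ℝ) (t : ℕ+ → ℝ),
      Measurable V → MeasurableSet E → Converges V E (2 * n) t →
        IntegrableOn (fun X : symMatrices (2 * n) => matrixWeight V t X)
            (symWithSpectrumIn (2 * n) E) dX ∧
          pfaffianTau V E (2 * n) t =
            c * ∫ X in symWithSpectrumIn (2 * n) E, matrixWeight V t X ∂dX := by
  obtain ⟨b, hb0, hbt, hb⟩ := exists_matrix_integral_eq (2 * n) dX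
  obtain ⟨c, hc, hcV⟩ := exists_pfaffianTau_eq n
  have hbpos : 0 < b.toReal := ENNReal.toReal_pos hb0 hbt
  -- Here `c` compares the tau function, and `b` the matrix integral, with the same integral `∫ |Δ|
  -- ∏ w` over the spectrum.
  refine ⟨c / b.toReal, by positivity, fun V E t hV hE ht => ?_⟩
  obtain ⟨hmeas, hint⟩ := hb V E (2 * n) t hV hE ht
  have hI := integrable_vandermonde ht
  have hI0 : ∀ x : Fin (2 * n) → ℝ, 0 ≤ |(vandermonde x).det| * ∏ i, lineWeight V t (x i) :=
    fun x => mul_nonneg (abs_nonneg _) (Finset.prod_nonneg fun i _ => lineWeight_nonneg V t _)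
  rw [← ofReal_integral_eq_lintegral_ofReal hI (Filter.Eventually.of_forall hI0)] at hint
  have hW0 : ∀ X : symMatrices (2 * n), 0 ≤ matrixWeight V t X := fun X => matrixWeight_nonneg V t X
  refine ⟨⟨hmeas.aestronglyMeasurable, ?_⟩, ?_⟩
  · rw [hasFiniteIntegral_iff_ofReal (Filter.Eventually.of_forall hW0), hint]
    exact ENNReal.mul_lt_top hbt.lt_top ENNReal.ofReal_lt_top
  · rw [integral_eq_lintegral_of_nonneg_ae (Filter.Eventually.of_forall hW0)
      hmeas.aestronglyMeasurable, hint, ENNReal.toReal_mul,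
      ENNReal.toReal_ofReal (integral_nonneg hI0), hcV V E t ht]
    field_simp

end SymMatrices

end PfaffianTau

theorem theorem5p1 :
    -- the two descriptions of the tau functions agree, up to the factor `l !`
    (∀ (V : ℝ → ℝ) (E : Set ℝ) (l : ℕ) (t s : ℕ+ → ℝ),
      Measurable V → MeasurableSet E →
      PfaffianTau.Converges V E l t → PfaffianTau.Converges V E l (-s) →
        MeasureTheory.IntegrableOn
            (fun p : (Fin l → ℝ) × (Fin l → ℝ) => PfaffianTau.multiIntegrand V t s l p.1 p.2)
            (PfaffianTau.box E l) ∧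
          (l.factorial : ℝ) * PfaffianTau.tau V E l t s =
            ∫ p in PfaffianTau.box E l, PfaffianTau.multiIntegrand V t s l p.1 p.2) ∧
    -- the symmetric matrix integral
    (∀ (n : ℕ) (dX : MeasureTheory.Measure (PfaffianTau.symMatrices (2 * n))),
      dX.IsAddHaarMeasure →
      ∃ c : ℝ, 0 < c ∧
        ∀ (V : ℝ → ℝ) (E : Set ℝ) (t : ℕ+ → ℝ),
          Measurable V → MeasurableSet E → PfaffianTau.Converges V E (2 * n) t →
            MeasureTheory.IntegrableOn
                (fun X : PfaffianTau.symMatrices (2 * n) => PfaffianTau.matrixWeight V t X)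
                (PfaffianTau.symWithSpectrumIn (2 * n) E) dX ∧
              PfaffianTau.pfaffianTau V E (2 * n) t =
                c * ∫ X in PfaffianTau.symWithSpectrumIn (2 * n) E,
                  PfaffianTau.matrixWeight V t X ∂dX) := by
  exact ⟨fun V E l t s _ _ ht hs => PfaffianTau.tau_eq_integral ht hs,
    fun n dX hdX => PfaffianTau.pfaffianTau_eq_matrix_integral n dX⟩
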